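/- Let $F$ be a number field with absolute Galois group $G_F=\mathrm{Gal}(\overline F/F)$, let $\ell$ be a prime number, let $K$ be either a finite field of characteristic $\ell$ or an algebraic closure $\overline{\mathbb F}_\ell$ of $\mathbb F_\ell$, and let $L/K$ be a (possibly infinite) Galois extension; $L$ carries the discrete topology. Let $\rho:G_F\to \mathrm{GL}_n(L)$ be a continuous representation, or, for $n$ even, a continuous representation $\rho:G_F\to\mathrm{GSp}_n(L)\subseteq\mathrm{GL}_n(L)$, and let $[\rho]$ be its equivalence class under conjugation by $\mathrm{GL}_n(L)$, respectively by $\mathrm{GSp}_n(L)$. An inner twist of $[\rho]$ is a pair $(\gamma,\epsilon)$ consisting of $\gamma\in\mathrm{Gal}(L/K)$ and a continuous character $\epsilon:G_F\to L^\times$ such that $[{}^\gamma\rho]=[\rho\otimes\epsilon]$, where ${}^\gamma\rho=\gamma\circ\rho$. Let $\mathfrak L$ be a prime of $F$ above $\ell$, and let $I_{\mathfrak L}\subseteq G_F$ be the inertia group of a prime $\mathfrak P$ of $\overline F$ above $\mathfrak L$. A fundamental character of niveau $r\ge 1$ of $I_{\mathfrak L}$ is a homomorphism $I_{\mathfrak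 L}\to\overline L^\times$ obtained by composing $\sigma\mapsto \sigma(x)/x \bmod \mathfrak P$, where $x^{\ell^r-1}=\pi$ for a uniformizer $\pi$ of $F$ at $\mathfrak L$, with an embedding into $\overline L$ of the residue field of $\mathfrak P$. (If $\mathfrak L$ is unramified over $\ell$, the one of niveau $1$ is the mod-$\ell$ cyclotomic character.) Fix a fundamental character $\psi_r$ of niveau $r$ for every $r\ge 1$. Assume that there are $t\in\mathbb Z$, an integer $1\le s\le n$, integers $r_1,\dots,r_s\ge 1$ with $r_1+\dots+r_s=n$, and tuples of integers $(a_{i,1},\dots,a_{i,r_i})$, $1\le i\le s$, with $0\le a_{i,j}\le \ell-1$, such that, with $b_i=\sum_{j=1}^{r_i}a_{i,j}\ell^{j-1}$ and $$B_i=\mathrm{diag}\bigl(\psi_{r_i}^{b_i},\psi_{r_i}^{b_i\ell},\dots,\psi_{r_i}^{b_i\ell^{r_i-1}}\bigr),$$ the representation $\rho|_{I_{\mathfrak L}}\otimes\psi_1^t$ is equivalent over $\overline L$ to a block upper triangular representation with diagonal blocks $B_1,\dots,B_s$, in this order. If $a_{i,j}<\frac{\ell-1}{2n}$ for all $1\le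 i\le s$ and $1\le j\le r_i$, then for every inner twist $(\gamma,\epsilon)$ of $[\rho]$ the character $\epsilon$ is unramified at $\mathfrak L$, i.e. trivial on the inertia groups of all primes of $\overline F$ above $\mathfrak L$. -/

import Mathlib

open scoped NumberField

noncomputable section

namespace InnerTwist

/-- The absolute Galois group `G_F = Gal(F̄/F)`, with its Krull topology. -/
abbrev GalGrp (F : Type*) [Field F] : Type _ :=
  AlgebraicClosure F ≃ₐ[F] AlgebraicClosure F

/-- The ring of all algebraic integers in `F̄`. -/
abbrev IntBar (F : Type*) [Field F] : Type _ := 𝓞 (AlgebraicClosure F)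

/-! ### Inertia and ramification -/

section Inertia

variable {F : Type*} [Field F]

/-- The inertia group in `G_F` of a prime `𝔓` of the ring of integers of `F̄`:
all `σ` with `σ x ≡ x mod 𝔓` for every algebraic integer `x`. -/
abbrev inertiaGrp (𝔓 : Ideal (IntBar F)) : Subgroup (GalGrp F) := 𝔓.inertia (GalGrp F)

/-- A homomorphism on `G_F` is unramified at the prime `𝔏` of `F` if it is trivial on the inertia
groups of all primes of `F̄` above `𝔏`. -/
def IsUnramifiedAt {H : Type*} [Group H] (f : GalGrp F →* H) (𝔏 : Ideal (𝓞 F)) : Prop :=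
  ∀ 𝔓 : Ideal (IntBar F), 𝔓.IsPrime → 𝔓.LiesOver 𝔏 → ∀ σ ∈ inertiaGrp 𝔓, f σ = 1

end Inertia

/-! ### Fundamental characters -/

section Fundamental

variable {F : Type*} [Field F]

lemma isIntegral_rootRatio {d : ℕ} (hd : d ≠ 0) {π : 𝓞 F} (hπ : π ≠ 0) {x : IntBar F}
    (hx : x ^ d = algebraMap (𝓞 F) (IntBar F) π) (σ : GalGrp F) :
    IsIntegral ℤ (σ (x : AlgebraicClosure F) / (x : AlgebraicClosure F)) := by
  have h : (x : AlgebraicClosure F) ^ d = algebraMap F (AlgebraicClosure F) (π : F) := by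
    have := congrArg (algebraMap (IntBar F) (AlgebraicClosure F)) hx
    rw [map_pow] at this
    exact this
  have hπ' : algebraMap F (AlgebraicClosure F) (π : F) ≠ 0 := by
    simpa using hπ
  refine IsIntegral.of_pow (Nat.pos_of_ne_zero hd) ?_
  rw [div_pow, ← map_pow, h, AlgEquiv.commutes, div_self hπ']
  exact isIntegral_one

/-- For an algebraic integer `x` with `x ^ d = π ∈ F`, the `d`-th root of unity `σ(x) / x`. -/
def rootRatio {d : ℕ} (hd : d ≠ 0) {π : 𝓞 F} (hπ : π ≠ 0) {x : IntBar F}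
    (hx : x ^ d = algebraMap (𝓞 F) (IntBar F) π) (σ : GalGrp F) : IntBar F :=
  ⟨σ (x : AlgebraicClosure F) / (x : AlgebraicClosure F), isIntegral_rootRatio hd hπ hx σ⟩

lemma coe_ne_zero_of_root {d : ℕ} (hd : d ≠ 0) {π : 𝓞 F} (hπ : π ≠ 0) {x : IntBar F}
    (hx : x ^ d = algebraMap (𝓞 F) (IntBar F) π) : (x : AlgebraicClosure F) ≠ 0 := by
  intro h
  have h0 : x = 0 := by
    apply NumberField.RingOfIntegers.ext
    simpa using h
  rw [h0, zero_pow hd] at hx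
  have h1 := congrArg (algebraMap (IntBar F) (AlgebraicClosure F)) hx
  rw [map_zero] at h1
  have h2 : algebraMap F (AlgebraicClosure F) (π : F) = 0 := h1.symm
  apply hπ
  simpa using h2

/-- The homomorphism `σ ↦ σ(x) / x mod 𝔓` on the inertia group of `𝔓`, where `x ^ d = π ∈ F`. -/
def rootCharacter (𝔓 : Ideal (IntBar F)) {d : ℕ} (hd : d ≠ 0) {π : 𝓞 F} (hπ : π ≠ 0)
    {x : IntBar F} (hx : x ^ d = algebraMap (𝓞 F) (IntBar F) π) :
    inertiaGrp 𝔓 →* (IntBar F ⧸ 𝔓)ˣ :=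
  MonoidHom.toHomUnits
    { toFun := fun σ => Ideal.Quotient.mk 𝔓 (rootRatio hd hπ hx (σ : GalGrp F))
      map_one' := by
        have hx0 := coe_ne_zero_of_root hd hπ hx
        have : rootRatio hd hπ hx ((1 : inertiaGrp 𝔓) : GalGrp F) = 1 := by
          apply NumberField.RingOfIntegers.ext
          exact div_self hx0
        rw [this, map_one]
      map_mul' := by
        intro σ τ
        have hx0 := coe_ne_zero_of_root hd hπ hx
        have h1 : rootRatio hd hπ hx ((σ * τ : inertiaGrp 𝔓) : GalGrp F) =
            ((σ : GalGrp F) • rootRatio hd hπ hx (τ : GalGrp F)) *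
              rootRatio hd hπ hx (σ : GalGrp F) := by
          apply NumberField.RingOfIntegers.ext
          change (σ : GalGrp F) ((τ : GalGrp F) (x : AlgebraicClosure F)) / x =
            (σ : GalGrp F) ((τ : GalGrp F) (x : AlgebraicClosure F) / x) *
              ((σ : GalGrp F) (x : AlgebraicClosure F) / x)
          have hs : (σ : GalGrp F) (x : AlgebraicClosure F) ≠ 0 := by simpa using hx0
          rw [map_div₀]
          field_simp
        have h2 : Ideal.Quotient.mk 𝔓 ((σ : GalGrp F) • rootRatio hd hπ hx (τ : GalGrp F)) =
            Ideal.Quotient.mk 𝔓 (rootRatio hd hπ hx (τ : GalGrp F)) :=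
          Ideal.Quotient.eq.2 (σ.2 _)
        rw [h1, map_mul, h2, mul_comm] }

/-- `ψ` is a fundamental character of niveau `r` of the inertia group of `𝔓`, for a prime `𝔓` of
`F̄` above the prime `𝔏 ∣ ℓ` of `F`, with values in a field `Ω` of characteristic `ℓ`:
it is `σ ↦ σ(x) / x mod 𝔓`, for a root `x = π ^ (1 / (ℓ ^ r - 1))` of a uniformizer `π` of `F` at
`𝔏`, followed by an embedding into `Ω` of the residue field of `𝔓`. The uniformizer and
its root do not affect the character; the embedding does, up to powers of Frobenius. -/
def IsFundamentalCharacter (ℓ : ℕ) (𝔏 : Ideal (𝓞 F)) (𝔓 : Ideal (IntBar F)) (r : ℕ)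
    {Ω : Type*} [Field Ω] (ψ : inertiaGrp 𝔓 →* Ωˣ) : Prop :=
  ∃ (hd : ℓ ^ r - 1 ≠ 0) (π : 𝓞 F) (hπ : π ≠ 0) (x : IntBar F)
    (hx : x ^ (ℓ ^ r - 1) = algebraMap (𝓞 F) (IntBar F) π) (τ : IntBar F ⧸ 𝔓 →+* Ω),
    π ∈ 𝔏 ∧ π ∉ 𝔏 ^ 2 ∧
      ψ = (Units.map (τ : IntBar F ⧸ 𝔓 →* Ω)).comp (rootCharacter 𝔓 hd hπ hx)

end Fundamental

/-! ### The shape of a representation on inertia -/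

section Shape

variable {F : Type*} [Field F] {L : Type*} [Field L] {n : ℕ}

/-- `b_i = a_{i,1} + a_{i,2} ℓ + ⋯ + a_{i,r_i} ℓ ^ (r_i - 1)`. -/
def digitSum (ℓ : ℕ) {r : ℕ} (a : Fin r → ℕ) : ℕ := ∑ j : Fin r, a j * ℓ ^ (j : ℕ)

/-- The diagonal matrix with entries `ψ^b, ψ^(b ℓ), …, ψ^(b ℓ^(r-1))`. -/
def diagBlock {I Ω : Type*} [Group I] [Field Ω] (ℓ r : ℕ) (ψ : I →* Ωˣ) (b : ℕ) (σ : I) :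
    Matrix (Fin r) (Fin r) Ω :=
  Matrix.diagonal fun j => ((ψ σ ^ (b * ℓ ^ (j : ℕ)) : Ωˣ) : Ω)

/-- The inertia-shape condition at `𝔓` for `ρ : G_F → GL_n(L)`, with twisting exponent `t`,
numbers `r_1, …, r_s` and tuples `S_i = (a_{i,1}, …, a_{i,r_i})`, relative to the family
`ψ r` of fundamental characters: over an algebraic closure of `L`, the restriction of `ρ ⊗ ψ_1 ^ t`
to the inertia group of `𝔓` is equivalent to a block upper triangular representation
with the diagonal blocks `B_1, …, B_s`. -/
structure HasInertiaShape (ℓ : ℕ) (𝔓 : Ideal (IntBar F)) (ρ : GalGrp F →* GL (Fin n) L)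
    (ψ : ℕ → inertiaGrp 𝔓 →* (AlgebraicClosure L)ˣ) (t : ℤ) (s : ℕ) (r : Fin s → ℕ)
    (a : (i : Fin s) → Fin (r i) → ℕ) : Prop where
  one_le_s : 1 ≤ s
  s_le : s ≤ n
  one_le_r : ∀ i, 1 ≤ r i
  digit_le : ∀ i j, a i j ≤ ℓ - 1
  shape : ∃ (hn : ∑ i, r i = n) (P : GL (Fin n) (AlgebraicClosure L)),
    ∀ σ : inertiaGrp 𝔓, ∃ M : Matrix ((i : Fin s) × Fin (r i)) ((i : Fin s) × Fin (r i))
        (AlgebraicClosure L),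
      M = ((P * (Matrix.GeneralLinearGroup.scalar (Fin n) (ψ 1 σ ^ t) *
              Matrix.GeneralLinearGroup.map (algebraMap L (AlgebraicClosure L))
                (ρ (σ : GalGrp F))) * P⁻¹ :
              GL (Fin n) (AlgebraicClosure L)) :
            Matrix (Fin n) (Fin n) (AlgebraicClosure L)).submatrix
          (finSigmaFinEquiv.trans (finCongr hn)) (finSigmaFinEquiv.trans (finCongr hn)) ∧
      M.BlockTriangular Sigma.fst ∧
      ∀ i, M.submatrix (Sigma.mk i) (Sigma.mk i) =
        diagBlock ℓ (r i) (ψ (r i)) (digitSum ℓ (a i)) σ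

end Shape

/-! ### Inner twists -/

section Twists

variable {G : Type*} [Group G] {L : Type*} [Field L] {n : ℕ}

/-- `ᵞρ`, the composition of `ρ` with `γ` acting on matrix entries. -/
def galConj {K : Type*} [Field K] [Algebra K L] (γ : L ≃ₐ[K] L) (ρ : G →* GL (Fin n) L) :
    G →* GL (Fin n) L :=
  (Matrix.GeneralLinearGroup.map (γ : L →+* L)).comp ρ

/-- `ρ ⊗ ε`. -/
def twist (ρ : G →* GL (Fin n) L) (ε : G →* Lˣ) : G →* GL (Fin n) L where
  toFun g := Matrix.GeneralLinearGroup.scalar (Fin n) (ε g) * ρ g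
  map_one' := by simp
  map_mul' g h := by
    have hc : Matrix.GeneralLinearGroup.scalar (Fin n) (ε h) * ρ g =
        ρ g * Matrix.GeneralLinearGroup.scalar (Fin n) (ε h) := by
      apply Units.ext
      exact Matrix.scalar_commute _ (fun _ => Commute.all _ _) _
    rw [map_mul, map_mul, map_mul, mul_assoc, ← mul_assoc _ (ρ g) (ρ h), hc]
    simp only [mul_assoc]

/-- Conjugacy of representations by an element of the subgroup `H` of `GL_n(L)`. -/
def ConjBy (H : Subgroup (GL (Fin n) L)) (ρ ρ' : G →* GL (Fin n) L) : Prop :=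
  ∃ M ∈ H, ∀ g, ρ' g = M * ρ g * M⁻¹

/-- The Gram matrix of the standard symplectic form on `L ^ n`, `n` even. -/
def sympGram (n : ℕ) (L : Type*) [Field L] : Matrix (Fin n) (Fin n) L :=
  Matrix.of fun i j =>
    if (i : ℕ) + n / 2 = j then 1 else if (j : ℕ) + n / 2 = i then -1 else 0

/-- The group `GSp_n(L)` of symplectic similitudes (`n` even). -/
def GSp (n : ℕ) (L : Type*) [Field L] : Subgroup (GL (Fin n) L) where
  carrier := {g | ∃ m : Lˣ, (g : Matrix (Fin n) (Fin n) L).transpose * sympGram n L *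
    (g : Matrix (Fin n) (Fin n) L) = (m : L) • sympGram n L}
  one_mem' := ⟨1, by simp⟩
  mul_mem' := by
    rintro g h ⟨m, hm⟩ ⟨m', hm'⟩
    refine ⟨m * m', ?_⟩
    have : ((g * h : GL (Fin n) L) : Matrix (Fin n) (Fin n) L).transpose * sympGram n L *
        ((g * h : GL (Fin n) L) : Matrix (Fin n) (Fin n) L) =
        (h : Matrix (Fin n) (Fin n) L).transpose *
          ((g : Matrix (Fin n) (Fin n) L).transpose * sympGram n L * g) * h := by
      simp [Matrix.transpose_mul, Matrix.mul_assoc]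
    rw [this, hm, Matrix.mul_smul, Matrix.smul_mul, hm', smul_smul, Units.val_mul]
  inv_mem' := by
    rintro g ⟨m, hm⟩
    refine ⟨m⁻¹, ?_⟩
    have h1 : (g : Matrix (Fin n) (Fin n) L) * ((g⁻¹ : GL (Fin n) L) : Matrix _ _ L) = 1 := by
      rw [← Units.val_mul, mul_inv_cancel, Units.val_one]
    have h2 : ((g⁻¹ : GL (Fin n) L) : Matrix _ _ L).transpose *
        (g : Matrix (Fin n) (Fin n) L).transpose = 1 := by
      rw [← Matrix.transpose_mul, h1, Matrix.transpose_one]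
    have h3 : sympGram n L = (m : L) • (((g⁻¹ : GL (Fin n) L) : Matrix _ _ L).transpose *
        sympGram n L * ((g⁻¹ : GL (Fin n) L) : Matrix _ _ L)) := by
      rw [← Matrix.smul_mul, ← Matrix.mul_smul, ← hm]
      calc sympGram n L = 1 * sympGram n L * 1 := by simp
        _ = (((g⁻¹ : GL (Fin n) L) : Matrix _ _ L).transpose *
              (g : Matrix (Fin n) (Fin n) L).transpose) * sympGram n L *
              ((g : Matrix (Fin n) (Fin n) L) * ((g⁻¹ : GL (Fin n) L) : Matrix _ _ L)) := by
            rw [h1, h2]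
        _ = _ := by simp only [Matrix.mul_assoc]
    conv_rhs => rw [h3]
    rw [smul_smul, Units.inv_mul, one_smul]

end Twists

/-- `(γ, ε)` is an inner twist of the `GL_n(L)`-equivalence class of `ρ`: `[ᵞρ] = [ρ ⊗ ε]`. -/
def IsInnerTwist {G : Type*} [Group G] {K L : Type*} [Field K] [Field L] [Algebra K L] {n : ℕ}
    (ρ : G →* GL (Fin n) L) (γ : L ≃ₐ[K] L) (ε : G →* Lˣ) : Prop :=
  ConjBy ⊤ (twist ρ ε) (galConj γ ρ)

/-- `(γ, ε)` is an inner twist of the symplectic equivalence class of `ρ : G → GSp_n(L)`,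
that is, for conjugation by elements of `GSp_n(L)`: `[ᵞρ] = [ρ ⊗ ε]`. -/
def IsSymplecticInnerTwist {G : Type*} [Group G] {K L : Type*} [Field K] [Field L] [Algebra K L]
    {n : ℕ} (ρ : G →* GL (Fin n) L) (γ : L ≃ₐ[K] L) (ε : G →* Lˣ) : Prop :=
  ConjBy (GSp n L) (twist ρ ε) (galConj γ ρ)

end InnerTwist

end

open scoped NumberField

noncomputable section

namespace InnerTwist

/-! ### Galois action on integers in an infinite extension; lifting inertia -/

section Invariants
open scoped Pointwise

variable (k : Type*) {Ω : Type*} [Field k] [Field Ω] [Algebra k Ω]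

/-! Compare eigenvalues on inertia. Extend `γ` to the algebraic closure of `L`. The values of the
fundamental characters lie in finite fields, so `γ` acts on them as a power of Frobenius. Each block
`B_i` is stable under Frobenius up to permutation, and the values of `ψ 1` lie in the prime field,
so `γ` preserves the multiset of diagonal entries. Since `ᵞρ` is conjugate to `ρ ⊗ ε`, that multiset
is also stable under multiplication by `ε σ` (`HasInertiaShape.map_diag_eq`).

Let `R = ∏ r_i`. Every diagonal character is a power `ψ R ^ v`, and the bound on the digits gives `n
* v < ℓ ^ R - 1` (`exists_small_exponent`). Choose `σ₀` with `ψ R σ₀ = ζ` of exact order `ℓ ^ R -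
1`. Taking products gives `ε σ₀ ^ n = 1`, while `ε σ₀ * ζ ^ v = ζ ^ v'` for some exponents of the
family; on raising to the `n`-th power, smallness forces `v = v'` and `ε σ₀ = 1`
(`eq_one_of_map_mul_eq`). On the kernel of `ψ R` all eigenvalues are `1`, so `ε` is trivial there
too. As `ζ` generates the image of `ψ R`, `ε` is trivial on the whole inertia group, and conjugation
carries this to the other primes above `𝔏`.

The arithmetic input is the existence of `σ₀` (`exists_orderOf_rootCharacter_eq`): adjoining all
`d`-th roots of a uniformizer gives ramification divisible by `d`, and inertia elements of that
finite extension lift to `F̄`. -/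

instance isInvariant_ringOfIntegers [IsGalois k Ω] :
    Algebra.IsInvariant (𝓞 k) (𝓞 Ω) (Ω ≃ₐ[k] Ω) := by
  refine ⟨fun b hb => ?_⟩
  have hb' : ∀ g : Ω ≃ₐ[k] Ω, g (b : Ω) = b := fun g =>
    congrArg (algebraMap (𝓞 Ω) Ω) (hb g)
  obtain ⟨y, hy⟩ := (InfiniteGalois.mem_range_algebraMap_iff_fixed (b : Ω)).2 hb'
  have hint : IsIntegral ℤ y := by
    rw [← isIntegral_algebraMap_iff (algebraMap k Ω).injective, hy]
    exact b.2
  refine ⟨⟨y, hint⟩, ?_⟩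
  apply NumberField.RingOfIntegers.ext
  exact hy

instance smulCommClass_ringOfIntegers :
    SMulCommClass (Ω ≃ₐ[k] Ω) (𝓞 k) (𝓞 Ω) := by
  refine ⟨fun g a b => ?_⟩
  rw [Algebra.smul_def, Algebra.smul_def, smul_mul']
  congr 1
  apply NumberField.RingOfIntegers.ext
  exact g.commutes _

/-- Stabilizers of integral elements are open in the Krull topology. This makes the results on
profinite group actions available for infinite Galois groups. -/
lemma continuousSMul_ringOfIntegers [Algebra.IsAlgebraic k Ω] [TopologicalSpace (𝓞 Ω)]
    [DiscreteTopology (𝓞 Ω)] : ContinuousSMul (Ω ≃ₐ[k] Ω) (𝓞 Ω) := by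
  refine ⟨continuous_prod_of_discrete_right.2 fun b => ?_⟩
  refine continuous_discrete_rng.2 fun c => isOpen_iff_mem_nhds.2 fun g hg => ?_
  have hopen := (stabilizer_isOpen_of_isIntegral (K := k) (b : Ω)).smul g
  refine Filter.mem_of_superset (hopen.mem_nhds ⟨1, one_mem _, by simp⟩) ?_
  rintro _ ⟨h, hh, rfl⟩
  have hb : h • b = b := NumberField.RingOfIntegers.ext hh
  rw [Set.mem_preimage, Set.mem_singleton_iff] at hg ⊢
  change (g * h) • b = c
  rw [mul_smul, hb]
  exact hg

lemma exists_smul_eq_of_under_eq [IsGalois k Ω] (P Q : Ideal (𝓞 Ω)) [P.IsPrime] [Q.IsPrime]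
    (h : P.under (𝓞 k) = Q.under (𝓞 k)) : ∃ g : Ω ≃ₐ[k] Ω, Q = g • P := by
  let _ : TopologicalSpace (𝓞 Ω) := ⊥
  have : DiscreteTopology (𝓞 Ω) := ⟨rfl⟩
  have := continuousSMul_ringOfIntegers k (Ω := Ω)
  exact Algebra.IsInvariant.exists_smul_of_under_eq_of_profinite P Q h

lemma stabilizerHom_surjective [IsGalois k Ω] (P : Ideal (𝓞 k)) (Q : Ideal (𝓞 Ω)) [Q.IsPrime]
    [Q.LiesOver P] : Function.Surjective (Ideal.Quotient.stabilizerHom Q P (Ω ≃ₐ[k] Ω)) := by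
  let _ : TopologicalSpace (𝓞 Ω) := ⊥
  have : DiscreteTopology (𝓞 Ω) := ⟨rfl⟩
  have := continuousSMul_ringOfIntegers k (Ω := Ω)
  exact Ideal.Quotient.stabilizerHom_surjective_of_profinite P Q

variable {k}

/-- Inertia elements of a normal subextension lift to inertia elements. -/
lemma exists_inertia_lift [IsGalois k Ω] (E : IntermediateField k Ω) [Normal k E]
    (Q : Ideal (𝓞 Ω)) [Q.IsPrime] (σ : E ≃ₐ[k] E)
    (hσ : σ ∈ (Q.under (𝓞 E)).inertia (E ≃ₐ[k] E)) :
    ∃ τ ∈ Q.inertia (Ω ≃ₐ[k] Ω), τ.restrictNormal E = σ := by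
  obtain ⟨τ, rfl⟩ := AlgEquiv.restrictNormalHom_surjective (F := k) (K₁ := E) Ω σ
  have key (y : 𝓞 E) : τ • algebraMap (𝓞 E) (𝓞 Ω) y =
      algebraMap (𝓞 E) (𝓞 Ω) (AlgEquiv.restrictNormalHom E τ • y) := by
    apply NumberField.RingOfIntegers.ext
    exact (AlgEquiv.restrictNormal_commutes τ E (y : E)).symm
  -- As `σ` is inertial, `τ` moves integers of `E` only by elements of `Q`, so `Q` and `τ⁻¹ • Q` lie
  -- over the same prime of `E`. An element `g` fixing `E` then corrects `τ` to an element of the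
  -- decomposition group of `Q`.
  have hunder : Q.under (𝓞 E) = (τ⁻¹ • Q).under (𝓞 E) := by
    ext y
    rw [Ideal.mem_comap, Ideal.mem_comap, Ideal.mem_inv_pointwise_smul_iff, key]
    have := hσ y
    rw [Submodule.mem_toAddSubgroup, Ideal.mem_comap, map_sub] at this
    rw [← sub_add_cancel (algebraMap (𝓞 E) (𝓞 Ω) (AlgEquiv.restrictNormalHom E τ • y))
      (algebraMap (𝓞 E) (𝓞 Ω) y)]
    exact ((Ideal.add_mem_iff_right _ this).symm)
  obtain ⟨g, hg⟩ := exists_smul_eq_of_under_eq E Q (τ⁻¹ • Q) hunder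
  have hgQ : (τ * g.restrictScalars k) • Q = Q := by
    have h1 : g.restrictScalars k • Q = g • Q := rfl
    rw [mul_smul, h1, ← hg, smul_inv_smul]
  let e := Ideal.Quotient.stabilizerHom Q (Q.under (𝓞 k)) (Ω ≃ₐ[k] Ω) ⟨τ * g.restrictScalars k, hgQ⟩
  -- The residue automorphism of the corrected lift is linear over the residue ring of `E`, again
  -- because `σ` is inertial. It is therefore induced by some `h` fixing `E`, and dividing by `h`
  -- makes the lift inertial without changing its restriction to `E`.
  let e' : (𝓞 Ω ⧸ Q) ≃ₐ[𝓞 E ⧸ Q.under (𝓞 E)] (𝓞 Ω ⧸ Q) :=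
    AlgEquiv.ofRingEquiv (f := e.toRingEquiv) (by
      intro y
      obtain ⟨y, rfl⟩ := Ideal.Quotient.mk_surjective y
      change Ideal.Quotient.mk Q ((τ * g.restrictScalars k) • algebraMap (𝓞 E) (𝓞 Ω) y) =
        Ideal.Quotient.mk Q (algebraMap (𝓞 E) (𝓞 Ω) y)
      have hgy : g.restrictScalars k • algebraMap (𝓞 E) (𝓞 Ω) y = algebraMap (𝓞 E) (𝓞 Ω) y := by
        apply NumberField.RingOfIntegers.ext
        exact g.commutes _
      rw [mul_smul, hgy, key, Ideal.Quotient.eq, ← map_sub]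
      exact hσ y)
  obtain ⟨h, hh⟩ := stabilizerHom_surjective E (Q.under (𝓞 E)) Q e'
  refine ⟨τ * g.restrictScalars k * ((h : Ω ≃ₐ[E] Ω)⁻¹).restrictScalars k, ?_, ?_⟩
  · intro x
    rw [Submodule.mem_toAddSubgroup, ← Ideal.Quotient.eq]
    have h2 := DFunLike.congr_fun hh
      (Ideal.Quotient.mk Q (((h : Ω ≃ₐ[E] Ω)⁻¹).restrictScalars k • x))
    have h3 : (h : Ω ≃ₐ[E] Ω) • (((h : Ω ≃ₐ[E] Ω)⁻¹).restrictScalars k • x) = x :=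
      smul_inv_smul (h : Ω ≃ₐ[E] Ω) x
    have h4 : Ideal.Quotient.mk Q
        ((h : Ω ≃ₐ[E] Ω) • (((h : Ω ≃ₐ[E] Ω)⁻¹).restrictScalars k • x)) =
        Ideal.Quotient.mk Q ((τ * g.restrictScalars k) •
          (((h : Ω ≃ₐ[E] Ω)⁻¹).restrictScalars k • x)) := h2
    rw [h3] at h4
    rw [mul_smul, ← h4]
  · refine AlgEquiv.ext fun y => ?_
    have h1 : ∀ u : Ω ≃ₐ[E] Ω, u.restrictScalars k (algebraMap E Ω y) = algebraMap E Ω y :=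
      fun u => u.commutes y
    apply (algebraMap E Ω).injective
    rw [AlgEquiv.restrictNormal_commutes, AlgEquiv.mul_apply, AlgEquiv.mul_apply, h1, h1]
    exact (AlgEquiv.restrictNormal_commutes τ E y).symm

end Invariants

/-! ### Tame characters and their surjectivity onto roots of unity -/

section Tame

/-- In a domain, `d`-th roots of unity are distinct modulo a prime not containing `d`. -/
lemma eq_of_pow_eq_one_of_sub_mem {B : Type*} [CommRing B] [IsDomain B] {Q : Ideal B} [Q.IsPrime]
    {d : ℕ} (hd : (d : B) ∉ Q) {u v : B} (hu : u ^ d = 1) (hv : v ^ d = 1) (h : u - v ∈ Q) :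
    u = v := by
  have hd0 : d ≠ 0 := by rintro rfl; simp at hd
  by_contra hne
  -- If `u ≠ v`, the cofactor of `u - v` in `u ^ d - v ^ d` vanishes; modulo `Q` it equals `d * v ^
  -- (d - 1)`, which is nonzero.
  have h1 : (∑ i ∈ Finset.range d, u ^ i * v ^ (d - 1 - i)) * (u - v) = 0 := by
    rw [(Commute.all u v).geom_sum₂_mul, hu, hv, sub_self]
  have h2 := (mul_eq_zero.1 h1).resolve_right (sub_ne_zero.2 hne)
  have h3 := congrArg (Ideal.Quotient.mk Q) h2
  rw [map_sum, map_zero] at h3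
  have huv : Ideal.Quotient.mk Q u = Ideal.Quotient.mk Q v := Ideal.Quotient.eq.2 h
  have h4 : ∀ i ∈ Finset.range d, Ideal.Quotient.mk Q (u ^ i * v ^ (d - 1 - i)) =
      Ideal.Quotient.mk Q (v ^ (d - 1)) := by
    intro i hi
    rw [map_mul, map_pow, huv, ← map_pow, ← map_mul, ← pow_add]
    congr 2
    have := Finset.mem_range.1 hi
    omega
  rw [Finset.sum_congr rfl h4, Finset.sum_const, Finset.card_range, nsmul_eq_mul,
    ← map_natCast (Ideal.Quotient.mk Q), ← map_mul, Ideal.Quotient.eq_zero_iff_mem] at h3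
  rcases Ideal.IsPrime.mem_or_mem ‹_› h3 with h5 | h5
  · exact hd h5
  · have : v ^ d ∈ Q := by
      rw [← Nat.succ_pred_eq_of_ne_zero hd0, pow_succ]
      exact Q.mul_mem_right _ h5
    rw [hv] at this
    exact Ideal.IsPrime.ne_top ‹_› ((Ideal.eq_top_iff_one _).2 this)

lemma perfectField_residueField {F : Type*} [Field F] [NumberField F] (𝔏 : Ideal (𝓞 F))
    [𝔏.IsPrime] (h0 : 𝔏 ≠ ⊥) : PerfectField 𝔏.ResidueField := by
  have : 𝔏.IsMaximal := Ideal.IsPrime.isMaximal ‹_› h0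
  have : Finite (𝓞 F ⧸ 𝔏) := Ideal.finiteQuotientOfFreeOfNeBot 𝔏 h0
  have : Finite 𝔏.ResidueField :=
    Finite.of_surjective _ (Ideal.bijective_algebraMap_quotient_residueField 𝔏).2
  infer_instance

/-- If `x ^ d` is a uniformizer at `𝔏`, then `d` divides the order of inertia. -/
lemma dvd_card_inertia {F E : Type*} [Field F] [NumberField F] [Field E] [NumberField E]
    [Algebra F E] [IsGalois F E] (𝔏 : Ideal (𝓞 F)) [𝔏.IsPrime] (h0 : 𝔏 ≠ ⊥)
    (Q : Ideal (𝓞 E)) [Q.IsPrime] [Q.LiesOver 𝔏] {d : ℕ} {π : 𝓞 F} (hπ : π ∈ 𝔏)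
    (hπ2 : π ∉ 𝔏 ^ 2) {x : 𝓞 E} (hx : x ^ d = algebraMap (𝓞 F) (𝓞 E) π) :
    d ∣ Nat.card (Q.inertia (E ≃ₐ[F] E)) := by
  have : PerfectField 𝔏.ResidueField := perfectField_residueField 𝔏 h0
  have : IsGaloisGroup (E ≃ₐ[F] E) (𝓞 F) (𝓞 E) :=
    IsGaloisGroup.of_isFractionRing (E ≃ₐ[F] E) (𝓞 F) (𝓞 E) F E
  have hQ0 : Q ≠ ⊥ := Ideal.ne_bot_of_liesOver_of_ne_bot h0 Q
  rw [Ideal.card_inertia_eq_ramificationIdxIn 𝔏 Q,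
    Ideal.ramificationIdxIn_eq_ramificationIdx 𝔏 Q (E ≃ₐ[F] E),
    ← Ideal.ramificationIdx'_eq_ramificationIdx 𝔏 Q h0]
  have hv := Ideal.prime_of_isPrime h0 ‹_›
  have hw := Ideal.prime_of_isPrime hQ0 ‹_›
  have hπ0 : π ≠ 0 := by rintro rfl; exact hπ2 (zero_mem _)
  -- Compute the `Q`-adic valuation of `π` twice: it is the ramification index, since `π` is a
  -- uniformizer, and `d` times the valuation of `x`.
  have h1 := Ideal.IsDedekindDomain.emultiplicity_map_eq_ramificationIdx'_mul
    (I := Ideal.span {π}) (by simpa using hπ0) hv.irreducible hw.irreducible hQ0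
  have h2 : emultiplicity 𝔏 (Ideal.span {π}) = (1 : ℕ) := by
    rw [emultiplicity_eq_coe]
    simpa [Ideal.dvd_span_singleton] using ⟨hπ, hπ2⟩
  rw [Ideal.map_span, Set.image_singleton, ← hx, ← Ideal.span_singleton_pow,
    emultiplicity_pow hw, h2, Nat.cast_one, mul_one] at h1
  rcases Nat.eq_zero_or_pos d with rfl | hd
  · simpa using h1.symm
  · generalize emultiplicity Q (Ideal.span {x}) = m at h1
    induction m using ENat.recTopCoe with
    | top =>
      rw [ENat.mul_top (by simpa using hd.ne')] at h1
      exact absurd h1 (ENat.top_ne_natCast _)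
    | coe m => exact ⟨m, by exact_mod_cast h1.symm⟩

variable {F : Type*} [Field F]

lemma coe_pow_of_root {d : ℕ} {π : 𝓞 F} {x : IntBar F}
    (hx : x ^ d = algebraMap (𝓞 F) (IntBar F) π) :
    (x : AlgebraicClosure F) ^ d = algebraMap F (AlgebraicClosure F) (π : F) := by
  have h := congrArg (algebraMap (IntBar F) (AlgebraicClosure F)) hx
  rwa [map_pow] at h

lemma rootRatio_pow {d : ℕ} (hd : d ≠ 0) {π : 𝓞 F} (hπ : π ≠ 0) {x : IntBar F}
    (hx : x ^ d = algebraMap (𝓞 F) (IntBar F) π) (σ : GalGrp F) :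
    rootRatio hd hπ hx σ ^ d = 1 := by
  apply NumberField.RingOfIntegers.ext
  have h' := coe_pow_of_root hx
  have hx0 := coe_ne_zero_of_root hd hπ hx
  change algebraMap (IntBar F) (AlgebraicClosure F) (_ ^ d) = algebraMap _ _ 1
  rw [map_pow, map_one]
  change (σ (x : AlgebraicClosure F) / x) ^ d = 1
  rw [div_pow, ← map_pow, h', AlgEquiv.commutes, ← h', div_self (pow_ne_zero _ hx0)]

lemma val_rootCharacter (𝔓 : Ideal (IntBar F)) {d : ℕ} (hd : d ≠ 0) {π : 𝓞 F} (hπ : π ≠ 0)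
    {x : IntBar F} (hx : x ^ d = algebraMap (𝓞 F) (IntBar F) π) (σ : inertiaGrp 𝔓) :
    (rootCharacter 𝔓 hd hπ hx σ : IntBar F ⧸ 𝔓) =
      Ideal.Quotient.mk 𝔓 (rootRatio hd hπ hx (σ : GalGrp F)) := rfl

lemma rootCharacter_pow (𝔓 : Ideal (IntBar F)) {d : ℕ} (hd : d ≠ 0) {π : 𝓞 F} (hπ : π ≠ 0)
    {x : IntBar F} (hx : x ^ d = algebraMap (𝓞 F) (IntBar F) π) (σ : inertiaGrp 𝔓) :
    rootCharacter 𝔓 hd hπ hx σ ^ d = 1 := by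
  apply Units.ext
  rw [Units.val_pow_eq_pow_val, val_rootCharacter, ← map_pow, rootRatio_pow, map_one, Units.val_one]

/-- An inertia element fixes the roots of unity of order prime to the residue characteristic. -/
lemma inertia_smul_eq_of_pow_eq_one {𝔓 : Ideal (IntBar F)} [𝔓.IsPrime] {d : ℕ}
    (hd : (d : IntBar F) ∉ 𝔓) {ζ : IntBar F} (hζ : ζ ^ d = 1) {σ : GalGrp F}
    (hσ : σ ∈ inertiaGrp 𝔓) : σ • ζ = ζ := by
  refine eq_of_pow_eq_one_of_sub_mem hd ?_ hζ (hσ ζ)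
  rw [← smul_pow', hζ, smul_one]

/-- The `d`-th roots of unity inject modulo `𝔓`, so the character determines the action on `x`. Any
other root of `π` is `x` times a root of unity, which inertia fixes. -/
lemma apply_eq_of_rootCharacter_eq {𝔓 : Ideal (IntBar F)} [𝔓.IsPrime] {d : ℕ} (hd : d ≠ 0)
    (hd' : (d : IntBar F) ∉ 𝔓) {π : 𝓞 F} (hπ : π ≠ 0)
    {x : IntBar F} (hx : x ^ d = algebraMap (𝓞 F) (IntBar F) π) {σ τ : inertiaGrp 𝔓}
    (h : rootCharacter 𝔓 hd hπ hx σ = rootCharacter 𝔓 hd hπ hx τ)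
    {y : AlgebraicClosure F} (hy : y ^ d = algebraMap F _ (π : F)) :
    (σ : GalGrp F) y = (τ : GalGrp F) y := by
  have hx0 := coe_ne_zero_of_root hd hπ hx
  have h1 : rootRatio hd hπ hx (σ : GalGrp F) = rootRatio hd hπ hx (τ : GalGrp F) := by
    refine eq_of_pow_eq_one_of_sub_mem hd' (rootRatio_pow ..) (rootRatio_pow ..) ?_
    rw [← Ideal.Quotient.eq]
    exact congrArg Units.val h
  have h2 : (σ : GalGrp F) (x : AlgebraicClosure F) / x = (τ : GalGrp F) x / x :=
    congrArg (algebraMap (IntBar F) (AlgebraicClosure F)) h1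
  have h3 : (σ : GalGrp F) (x : AlgebraicClosure F) = (τ : GalGrp F) x := by
    rwa [div_left_inj' hx0] at h2
  have hxd : (x : AlgebraicClosure F) ^ d = algebraMap F _ (π : F) := coe_pow_of_root hx
  have hz : (y / x) ^ d = 1 := by
    rw [div_pow, hy, ← hxd, div_self (pow_ne_zero _ hx0)]
  let ζ : IntBar F := ⟨y / x, IsIntegral.of_pow (Nat.pos_of_ne_zero hd) (hz ▸ isIntegral_one)⟩
  have hζ : ζ ^ d = 1 := by
    apply NumberField.RingOfIntegers.ext
    change algebraMap (IntBar F) (AlgebraicClosure F) (_ ^ d) = algebraMap _ _ 1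
    rw [map_pow, map_one]
    exact hz
  have h4 : ∀ ρ : inertiaGrp 𝔓, (ρ : GalGrp F) (y / x) = y / x := fun ρ =>
    congrArg (algebraMap (IntBar F) (AlgebraicClosure F))
      (inertia_smul_eq_of_pow_eq_one hd' hζ ρ.2)
  have h5 : y = y / x * x := by field_simp
  rw [h5, map_mul, map_mul, h4, h4, h3]

open Polynomial in
/-- The tame character attached to a `d`-th root of a uniformizer is onto the `d`-th roots of
unity, when `d` is prime to the residue characteristic. -/
lemma exists_orderOf_rootCharacter_eq [NumberField F] (𝔏 : Ideal (𝓞 F)) [𝔏.IsPrime] (h0 : 𝔏 ≠ ⊥)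
    (𝔓 : Ideal (IntBar F)) [𝔓.IsPrime] [𝔓.LiesOver 𝔏] {d : ℕ} (hd : d ≠ 0)
    (hd' : (d : IntBar F) ∉ 𝔓) {π : 𝓞 F} (hπ : π ≠ 0) (hπ1 : π ∈ 𝔏) (hπ2 : π ∉ 𝔏 ^ 2)
    {x : IntBar F} (hx : x ^ d = algebraMap (𝓞 F) (IntBar F) π) :
    ∃ σ : inertiaGrp 𝔓, orderOf (rootCharacter 𝔓 hd hπ hx σ) = d := by
  let p : F[X] := X ^ d - C (π : F)
  let E : IntermediateField F (AlgebraicClosure F) :=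
    IntermediateField.adjoin F (p.rootSet (AlgebraicClosure F))
  have hp0 : p ≠ 0 := X_pow_sub_C_ne_zero (Nat.pos_of_ne_zero hd) _
  have hmem : ∀ y : AlgebraicClosure F, y ∈ p.rootSet (AlgebraicClosure F) ↔
      y ^ d = algebraMap F _ (π : F) := by
    intro y
    rw [mem_rootSet_of_ne hp0]
    simp [p, sub_eq_zero]
  have : p.IsSplittingField F E :=
    IntermediateField.adjoin_rootSet_isSplittingField (IsAlgClosed.splits _)
  have : FiniteDimensional F E := IsSplittingField.finiteDimensional E p
  have : Normal F E := Normal.of_isSplittingField p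
  have : IsGalois F E := { }
  have : NumberField E := NumberField.of_module_finite F E
  have hxd : (x : AlgebraicClosure F) ^ d = algebraMap F _ (π : F) := coe_pow_of_root hx
  let x' : 𝓞 E := ⟨⟨(x : AlgebraicClosure F), IntermediateField.subset_adjoin _ _ ((hmem _).2 hxd)⟩,
    (isIntegral_algebraMap_iff (algebraMap E (AlgebraicClosure F)).injective).1 x.2⟩
  have hx' : x' ^ d = algebraMap (𝓞 F) (𝓞 E) π := by
    apply NumberField.RingOfIntegers.ext
    apply (algebraMap E (AlgebraicClosure F)).injective
    change algebraMap E (AlgebraicClosure F) (algebraMap (𝓞 E) E (x' ^ d)) = _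
    rw [map_pow, map_pow]
    exact hxd
  have hover : (𝔓.under (𝓞 E)).LiesOver 𝔏 := by
    refine ⟨?_⟩
    rw [Ideal.under_under]
    exact Ideal.over_def 𝔓 𝔏
  have hdvd := dvd_card_inertia 𝔏 h0 (𝔓.under (𝓞 E)) hπ1 hπ2 hx'
  choose lift hlift hres using fun σ : (𝔓.under (𝓞 E)).inertia (E ≃ₐ[F] E) =>
    exists_inertia_lift E 𝔓 σ.1 σ.2
  let H := (rootCharacter 𝔓 hd hπ hx).range
  have hpow : ∀ h ∈ H, h ^ d = 1 := by
    rintro _ ⟨σ, rfl⟩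
    exact rootCharacter_pow ..
  have : NeZero d := ⟨hd⟩
  have hH : H ≤ rootsOfUnity d (IntBar F ⧸ 𝔓) := fun h hh => hpow h hh
  have : Finite H := Finite.of_injective _ (Subgroup.inclusion_injective hH)
  let f : (𝔓.under (𝓞 E)).inertia (E ≃ₐ[F] E) → H := fun σ =>
    ⟨rootCharacter 𝔓 hd hπ hx ⟨lift σ, hlift σ⟩, ⟨_, rfl⟩⟩
  -- `E` is generated by the `d`-th roots of `π`, on which an inertia element is determined by its
  -- character value.
  have hf : Function.Injective f := by
    intro σ τ h
    have hrc := congrArg Subtype.val h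
    apply Subtype.ext
    rw [← hres σ, ← hres τ]
    have hEq : ∀ y ∈ E, lift σ y = lift τ y := by
      intro y hy
      induction hy using IntermediateField.adjoin_induction with
      | mem y hy => exact apply_eq_of_rootCharacter_eq hd hd' hπ hx hrc ((hmem y).1 hy)
      | algebraMap y => rw [AlgEquiv.commutes, AlgEquiv.commutes]
      | add y z _ _ h1 h2 => rw [map_add, map_add, h1, h2]
      | inv y _ h1 => rw [map_inv₀, map_inv₀, h1]
      | mul y z _ _ h1 h2 => rw [map_mul, map_mul, h1, h2]
    refine AlgEquiv.ext fun y => ?_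
    apply (algebraMap E (AlgebraicClosure F)).injective
    rw [AlgEquiv.restrictNormal_commutes, AlgEquiv.restrictNormal_commutes]
    exact hEq _ y.2
  have hcard : d ≤ Nat.card H :=
    (Nat.le_of_dvd Nat.card_pos hdvd).trans (Nat.card_le_card_of_injective f hf)
  -- A finite group of roots of unity in a domain is cyclic. `H` has at least `d` elements and
  -- exponent dividing `d`, so a generator has order exactly `d`.
  obtain ⟨g, hg⟩ := IsCyclic.exists_generator (α := H)
  obtain ⟨σ, hσ⟩ := g.2
  refine ⟨σ, le_antisymm (orderOf_le_of_pow_eq_one (Nat.pos_of_ne_zero hd)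
    (rootCharacter_pow ..)) ?_⟩
  rw [hσ, Subgroup.orderOf_coe, orderOf_eq_card_of_forall_mem_zpowers hg]
  exact hcard

end Tame

/-! ### Embeddings of finite fields up to Frobenius -/

section Frobenius

/-- Two ring homomorphisms into a field of characteristic `ℓ` differ, on the elements of a finite
field, by a power of Frobenius. -/
lemma exists_eq_pow_frobenius (ℓ : ℕ) [Fact ℓ.Prime] {D Ω : Type*} [CommRing D] [IsDomain D]
    [CharP D ℓ] [Field Ω] (f g : D →+* Ω) {R : ℕ} (hR : R ≠ 0) :
    ∃ j : ℕ, ∀ x : D, x ^ ℓ ^ R = x → f x = g x ^ ℓ ^ j := by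
  have hℓ : 1 < ℓ ^ R := Nat.one_lt_pow hR (Fact.out : ℓ.Prime).one_lt
  let S : Subring D := RingHom.eqLocus (iterateFrobenius D ℓ R) (RingHom.id D)
  have : Finite S := by
    have hp : (Polynomial.X ^ ℓ ^ R - Polynomial.X : Polynomial D) ≠ 0 :=
      (Polynomial.monic_X_pow_sub (by
        rw [Polynomial.degree_X]
        exact_mod_cast hℓ)).ne_zero
    have hfin : {x : D | x ^ ℓ ^ R = x}.Finite :=
      (Polynomial.finite_setOfPred_isRoot hp).subset fun x hx => by
        have hx' : x ^ ℓ ^ R = x := hx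
        change Polynomial.IsRoot _ x
        rw [Polynomial.IsRoot.def, Polynomial.eval_sub, Polynomial.eval_pow,
          Polynomial.eval_X, hx', sub_self]
    exact hfin.to_subtype
  let _ : Field S := (Finite.isDomain_to_isField S).toField
  have : CharP S ℓ := inferInstance
  let _ : Algebra (ZMod ℓ) S := ZMod.algebra S ℓ
  let _ : Algebra S Ω := (g.comp S.subtype).toAlgebra
  let _ : Algebra (ZMod ℓ) Ω := ((algebraMap S Ω).comp (algebraMap (ZMod ℓ) S)).toAlgebra
  have : IsScalarTower (ZMod ℓ) S Ω := IsScalarTower.of_algebraMap_eq fun _ => rfl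
  -- View `Ω` as an extension of the finite field `S` through `g`. Normality of `S` over the prime
  -- field turns `f` into an automorphism of `S`, hence a power of Frobenius.
  let φ : S →ₐ[ZMod ℓ] Ω :=
    { f.comp S.subtype with
      commutes' := fun r => DFunLike.congr_fun (RingHom.ext_zmod
        ((f.comp S.subtype).comp (algebraMap (ZMod ℓ) S)) (algebraMap (ZMod ℓ) Ω)) r }
  obtain ⟨j, hj⟩ := (FiniteField.bijective_frobeniusAlgHom_pow (ZMod ℓ) S).2 (φ.restrictNormal S)
  refine ⟨j, fun x hx => ?_⟩
  have h := AlgHom.restrictNormal_commutes φ S ⟨x, hx⟩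
  rw [← hj] at h
  simp only [AlgHom.coe_pow, FiniteField.coe_frobeniusAlgHom, pow_iterate, ZMod.card] at h
  rw [map_pow] at h
  exact h.symm

end Frobenius

/-! ### Independence of the uniformizer and compatibility between niveaux -/

section Comparison

variable {F : Type*} [Field F]

/-- Two uniformizers differ by a local unit, written here as a fraction with numerator and
denominator prime to `𝔏`. Write `(π') = 𝔏 J` with `J` not inside `𝔏`, and take `u` in `J` outside
`𝔏`. -/
lemma exists_mul_eq_mul_of_uniformizers [NumberField F] {𝔏 : Ideal (𝓞 F)} [𝔏.IsPrime]
    {π π' : 𝓞 F} (h1 : π ∈ 𝔏) (h2 : π ∉ 𝔏 ^ 2) (h1' : π' ∈ 𝔏) (h2' : π' ∉ 𝔏 ^ 2) :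
    ∃ u w : 𝓞 F, u ∉ 𝔏 ∧ w ∉ 𝔏 ∧ π * u = π' * w := by
  obtain ⟨J, hJ⟩ := Ideal.dvd_span_singleton.2 h1'
  have hJ𝔏 : ¬ J ≤ 𝔏 := by
    intro hle
    apply h2'
    rw [← Ideal.span_singleton_le_iff_mem, hJ, pow_two]
    exact Ideal.mul_mono_right hle
  obtain ⟨u, huJ, hu⟩ := Set.not_subset.1 hJ𝔏
  have hmem : π * u ∈ Ideal.span {π'} := hJ ▸ Ideal.mul_mem_mul h1 huJ
  obtain ⟨w, hw⟩ := Ideal.mem_span_singleton'.1 hmem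
  refine ⟨u, w, hu, ?_, by rw [← hw, mul_comm]⟩
  intro hw𝔏
  have h3 : u * π ∈ 𝔏 ^ 2 := by
    rw [mul_comm, ← hw, pow_two]
    exact Ideal.mul_mem_mul hw𝔏 h1'
  rcases Ideal.IsPrime.mul_mem_pow 𝔏 h3 with h | h
  · exact hu h
  · exact h2 h

/-- An inertia element fixes the `d`-th roots of an element of `F` prime to `𝔏`. -/
lemma inertia_smul_eq_of_pow_eq {𝔏 : Ideal (𝓞 F)} {𝔓 : Ideal (IntBar F)} [𝔓.IsPrime]
    [𝔓.LiesOver 𝔏] {d : ℕ} (hd : d ≠ 0) (hd' : (d : IntBar F) ∉ 𝔓) {u : 𝓞 F} (hu : u ∉ 𝔏)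
    {U : IntBar F} (hU : U ^ d = algebraMap (𝓞 F) (IntBar F) u) {σ : GalGrp F}
    (hσ : σ ∈ inertiaGrp 𝔓) : σ • U = U := by
  have hu0 : u ≠ 0 := by rintro rfl; exact hu (zero_mem _)
  have hUP : U ∉ 𝔓 := by
    intro h
    apply hu
    rw [Ideal.over_def 𝔓 𝔏, Ideal.mem_comap, ← hU]
    exact Ideal.pow_mem_of_mem _ h _ (Nat.pos_of_ne_zero hd)
  have h1 : rootRatio hd hu0 hU σ * U = σ • U := by
    apply NumberField.RingOfIntegers.ext
    exact div_mul_cancel₀ _ (coe_ne_zero_of_root hd hu0 hU)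
  -- Since `U` is a unit modulo `𝔓`, the root of unity `σ U / U` is congruent to `1`, hence equal to
  -- `1`.
  have h2 : rootRatio hd hu0 hU σ = 1 := by
    refine eq_of_pow_eq_one_of_sub_mem hd' (rootRatio_pow ..) (one_pow d) ?_
    refine (Ideal.IsPrime.mem_or_mem ‹_› (?_ : _ * U ∈ 𝔓)).resolve_right hUP
    rw [sub_mul, one_mul, h1]
    exact hσ U
  rw [← h1, h2, one_mul]

lemma exists_pow_eq_algebraMap {d : ℕ} (hd : d ≠ 0) (u : 𝓞 F) :
    ∃ U : IntBar F, U ^ d = algebraMap (𝓞 F) (IntBar F) u := by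
  obtain ⟨z, hz⟩ := IsAlgClosed.exists_pow_nat_eq (algebraMap F (AlgebraicClosure F) (u : F))
    (Nat.pos_of_ne_zero hd)
  have hint : IsIntegral ℤ z := IsIntegral.of_pow (Nat.pos_of_ne_zero hd)
    (hz ▸ (algebraMap (𝓞 F) (IntBar F) u).2)
  let U : IntBar F := ⟨z, hint⟩
  refine ⟨U, ?_⟩
  apply NumberField.RingOfIntegers.ext
  change algebraMap (IntBar F) (AlgebraicClosure F) (U ^ d) = _
  rw [map_pow]
  exact hz

/-- The tame character does not depend on the uniformizer and its root. -/
lemma rootCharacter_eq [NumberField F] {𝔏 : Ideal (𝓞 F)} [𝔏.IsPrime]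
    {𝔓 : Ideal (IntBar F)} [𝔓.IsPrime] [𝔓.LiesOver 𝔏] {d : ℕ} (hd : d ≠ 0)
    (hd' : (d : IntBar F) ∉ 𝔓) {π π' : 𝓞 F} (hπ : π ≠ 0) (hπ' : π' ≠ 0)
    (h1 : π ∈ 𝔏) (h2 : π ∉ 𝔏 ^ 2) (h1' : π' ∈ 𝔏) (h2' : π' ∉ 𝔏 ^ 2) {x x' : IntBar F}
    (hx : x ^ d = algebraMap (𝓞 F) (IntBar F) π) (hx' : x' ^ d = algebraMap (𝓞 F) (IntBar F) π') :
    rootCharacter 𝔓 hd hπ hx = rootCharacter 𝔓 hd hπ' hx' := by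
  obtain ⟨u, w, hu, hw, huw⟩ := exists_mul_eq_mul_of_uniformizers h1 h2 h1' h2'
  obtain ⟨U, hU⟩ := exists_pow_eq_algebraMap hd u
  obtain ⟨W, hW⟩ := exists_pow_eq_algebraMap hd w
  have hu0 : u ≠ 0 := by rintro rfl; exact hu (zero_mem _)
  have hw0 : w ≠ 0 := by rintro rfl; exact hw (zero_mem _)
  have hx0 := coe_ne_zero_of_root hd hπ hx
  have hx'0 := coe_ne_zero_of_root hd hπ' hx'
  have hU0 := coe_ne_zero_of_root hd hu0 hU
  have hW0 := coe_ne_zero_of_root hd hw0 hW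
  ext σ
  rw [val_rootCharacter, val_rootCharacter]
  congr 1
  have hUσ : (σ : GalGrp F) (U : AlgebraicClosure F) = U :=
    congrArg (algebraMap (IntBar F) (AlgebraicClosure F))
      (inertia_smul_eq_of_pow_eq hd hd' hu hU σ.2)
  have hWσ : (σ : GalGrp F) (W : AlgebraicClosure F) = W :=
    congrArg (algebraMap (IntBar F) (AlgebraicClosure F))
      (inertia_smul_eq_of_pow_eq hd hd' hw hW σ.2)
  -- `x U / (x' W)` is a `d`-th root of unity. Inertia fixes it along with `U` and `W`, so it fixes
  -- `x / x'`.
  have hz : ((x : AlgebraicClosure F) * U / (x' * W)) ^ d = 1 := by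
    have h3 := congrArg (fun z : 𝓞 F => algebraMap F (AlgebraicClosure F) (z : F)) huw
    simp only [map_mul] at h3
    rw [← coe_pow_of_root hx, ← coe_pow_of_root hx', ← coe_pow_of_root hU,
      ← coe_pow_of_root hW, ← mul_pow, ← mul_pow] at h3
    rw [div_pow, h3, div_self (pow_ne_zero _ (mul_ne_zero hx'0 hW0))]
  let ζ : IntBar F := ⟨_, IsIntegral.of_pow (Nat.pos_of_ne_zero hd) (hz ▸ isIntegral_one)⟩
  have hζ : ζ ^ d = 1 := by
    apply NumberField.RingOfIntegers.ext
    change algebraMap (IntBar F) (AlgebraicClosure F) (_ ^ d) = algebraMap _ _ 1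
    rw [map_pow, map_one]
    exact hz
  have h4 : (σ : GalGrp F) ((x : AlgebraicClosure F) * U / (x' * W)) = x * U / (x' * W) :=
    congrArg (algebraMap (IntBar F) (AlgebraicClosure F))
      (inertia_smul_eq_of_pow_eq_one hd' hζ σ.2)
  have hσx' : (σ : GalGrp F) (x' : AlgebraicClosure F) ≠ 0 := by simpa using hx'0
  rw [map_div₀, map_mul, map_mul, hUσ, hWσ] at h4
  apply NumberField.RingOfIntegers.ext
  change (σ : GalGrp F) (x : AlgebraicClosure F) / x = (σ : GalGrp F) (x' : AlgebraicClosure F) / x'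
  field_simp at h4 ⊢
  linear_combination h4

/-- Compatibility of tame characters: a root of smaller order is a power of one of larger order. -/
lemma rootCharacter_eq_pow [NumberField F] {𝔏 : Ideal (𝓞 F)} [𝔏.IsPrime]
    {𝔓 : Ideal (IntBar F)} [𝔓.IsPrime] [𝔓.LiesOver 𝔏] {d m D : ℕ} (hdm : D = d * m) (hd : d ≠ 0)
    (hD : D ≠ 0)
    (hd' : (d : IntBar F) ∉ 𝔓) {π π' : 𝓞 F} (hπ : π ≠ 0) (hπ' : π' ≠ 0)
    (h1 : π ∈ 𝔏) (h2 : π ∉ 𝔏 ^ 2) (h1' : π' ∈ 𝔏) (h2' : π' ∉ 𝔏 ^ 2) {x x' : IntBar F}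
    (hx : x ^ d = algebraMap (𝓞 F) (IntBar F) π)
    (hx' : x' ^ D = algebraMap (𝓞 F) (IntBar F) π') (σ : inertiaGrp 𝔓) :
    rootCharacter 𝔓 hd hπ hx σ = rootCharacter 𝔓 hD hπ' hx' σ ^ m := by
  subst hdm
  -- The power `x' ^ m` is itself a `d`-th root of `π'`, so independence of the chosen root applies.
  have hy : (x' ^ m) ^ d = algebraMap (𝓞 F) (IntBar F) π' := by rw [← pow_mul, mul_comm m d, hx']
  rw [rootCharacter_eq hd hd' hπ hπ' h1 h2 h1' h2' hx hy]
  apply Units.ext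
  rw [Units.val_pow_eq_pow_val, val_rootCharacter, val_rootCharacter, ← map_pow]
  congr 1
  apply NumberField.RingOfIntegers.ext
  have e1 : ((x' ^ m : IntBar F) : AlgebraicClosure F) = (x' : AlgebraicClosure F) ^ m :=
    map_pow (algebraMap (IntBar F) (AlgebraicClosure F)) _ _
  have e2 : ((rootRatio hD hπ' hx' (σ : GalGrp F) ^ m : IntBar F) : AlgebraicClosure F) =
      ((σ : GalGrp F) (x' : AlgebraicClosure F) / x') ^ m :=
    map_pow (algebraMap (IntBar F) (AlgebraicClosure F)) _ _
  rw [e2]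
  change (σ : GalGrp F) ((x' ^ m : IntBar F) : AlgebraicClosure F) / ((x' ^ m : IntBar F) : _) = _
  rw [e1, map_pow, div_pow]

end Comparison

/-! ### Eigenvalues of block triangular matrices -/

section Charpoly

variable {Ω : Type*} [Field Ω] {s : ℕ} {r : Fin s → ℕ}

open Polynomial in
-- In the lexicographic order on pairs, a block triangular matrix with diagonal blocks is upper
-- triangular.
lemma roots_charpoly_of_blockTriangular
    (M : Matrix ((i : Fin s) × Fin (r i)) ((i : Fin s) × Fin (r i)) Ω)
    (hM : M.BlockTriangular Sigma.fst) (hD : ∀ i j k, j ≠ k → M ⟨i, j⟩ ⟨i, k⟩ = 0) :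
    M.charpoly.roots = Finset.univ.val.map fun x => M x x := by
  let e : ((i : Fin s) × Fin (r i)) ≃ (Σₗ i : Fin s, Fin (r i)) := toLex
  have htri : (Matrix.reindex e e M).BlockTriangular id := by
    intro x y hxy
    change M (e.symm x) (e.symm y) = 0
    rcases (Sigma.Lex.lt_def (a := y) (b := x)).1 hxy with h | ⟨h, h'⟩
    · exact hM h
    · obtain ⟨i, j⟩ := x
      obtain ⟨i', j'⟩ := y
      obtain rfl : i' = i := h
      exact hD i' j j' (ne_of_gt h')
  have h : M.charpoly = ∏ x, (X - C (M x x)) := by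
    rw [← Matrix.charpoly_reindex e, Matrix.charpoly_of_isUpperTriangular _ htri]
    exact Fintype.prod_equiv e.symm _ _ fun x => rfl
  have h' : (Finset.univ.val.map fun x => X - C (M x x)) =
      (Finset.univ.val.map fun x => M x x).map fun a => X - C a := by
    rw [Multiset.map_map]
    rfl
  rw [h, Finset.prod_eq_multiset_prod, h', roots_multiset_prod_X_sub_C]

lemma charpoly_conj_submatrix {n : ℕ} {κ : Type*} [Fintype κ] [DecidableEq κ] (q : κ ≃ Fin n)
    (P : GL (Fin n) Ω) (A : Matrix (Fin n) (Fin n) Ω) :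
    (((P : Matrix (Fin n) (Fin n) Ω) * A * ((P⁻¹ : GL (Fin n) Ω) : Matrix (Fin n) (Fin n) Ω)).submatrix
      q q).charpoly = A.charpoly := by
  have h := Matrix.charpoly_reindex q.symm
    ((P : Matrix (Fin n) (Fin n) Ω) * A * ((P⁻¹ : GL (Fin n) Ω) : Matrix (Fin n) (Fin n) Ω))
  rw [Matrix.reindex_apply, Equiv.symm_symm] at h
  rw [h, Matrix.coe_units_inv, Matrix.charpoly_units_conj]

/-- Comparison of eigenvalues for a matrix `A` whose conjugate by `θ` is similar to `e • A`. -/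
lemma map_diag_eq_of_conj {n : ℕ} (q : ((i : Fin s) × Fin (r i)) ≃ Fin n) (P U : GL (Fin n) Ω)
    (A : Matrix (Fin n) (Fin n) Ω) (θ : Ω →+* Ω) (e : Ω)
    (hA : A.map θ = (U : Matrix (Fin n) (Fin n) Ω) * (e • A) *
      ((U⁻¹ : GL (Fin n) Ω) : Matrix (Fin n) (Fin n) Ω))
    (M : Matrix ((i : Fin s) × Fin (r i)) ((i : Fin s) × Fin (r i)) Ω)
    (hMA : M = ((P : Matrix (Fin n) (Fin n) Ω) * A *
      ((P⁻¹ : GL (Fin n) Ω) : Matrix (Fin n) (Fin n) Ω)).submatrix q q)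
    (hM : M.BlockTriangular Sigma.fst) (hD : ∀ i j k, j ≠ k → M ⟨i, j⟩ ⟨i, k⟩ = 0) :
    (Finset.univ.val.map fun x => θ (M x x)) = Finset.univ.val.map fun x => e * M x x := by
  -- Conjugation invariance links the characteristic polynomials of `M.map θ`, `A.map θ`, `e • A`
  -- and `e • M` in turn.
  have h1 : (M.map θ).charpoly = (e • M).charpoly := by
    have h2 : e • M = ((P : Matrix (Fin n) (Fin n) Ω) * (e • A) *
        ((P⁻¹ : GL (Fin n) Ω) : Matrix (Fin n) (Fin n) Ω)).submatrix q q := by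
      rw [hMA, Matrix.mul_smul, Matrix.smul_mul]
      rfl
    rw [Matrix.charpoly_map, hMA, charpoly_conj_submatrix, ← Matrix.charpoly_map, hA, ← hMA, h2,
      charpoly_conj_submatrix, Matrix.coe_units_inv, Matrix.charpoly_units_conj]
  have h3 := roots_charpoly_of_blockTriangular (M.map θ)
    (fun x y hxy => by rw [Matrix.map_apply, hM hxy, map_zero])
    (fun i j k hjk => by rw [Matrix.map_apply, hD i j k hjk, map_zero])
  have h4 := roots_charpoly_of_blockTriangular (e • M)
    (fun x y hxy => by rw [Matrix.smul_apply, hM hxy, smul_zero])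
    (fun i j k hjk => by rw [Matrix.smul_apply, hD i j k hjk, smul_zero])
  rw [h1, h4] at h3
  exact h3.symm

end Charpoly

/-! ### Base-`ℓ` digits and stability of small exponents -/

section Digits

/-- Compare digit by digit with `ℓ ^ r - 1`, whose digits all equal `ℓ - 1`; strictness needs at
least one digit. -/
lemma digitSum_lt (ℓ : ℕ) (hℓ : 0 < ℓ) (N : ℕ) {r : ℕ} (hr : 1 ≤ r) (a : Fin r → ℕ)
    (ha : ∀ j, N * a j < ℓ - 1) : N * digitSum ℓ a < ℓ ^ r - 1 := by
  have h1 : (∑ j : Fin r, (ℓ - 1) * ℓ ^ (j : ℕ)) = ℓ ^ r - 1 := by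
    rw [Fin.sum_univ_eq_sum_range (fun j => (ℓ - 1) * ℓ ^ j) r, ← Finset.mul_sum, mul_comm]
    exact geom_sum_mul_of_one_le hℓ r
  rw [← h1, digitSum, Finset.mul_sum]
  have : Nonempty (Fin r) := ⟨⟨0, hr⟩⟩
  refine Finset.sum_lt_sum_of_nonempty Finset.univ_nonempty fun j _ => ?_
  rw [← mul_assoc]
  exact Nat.mul_lt_mul_of_pos_right (ha j) (pow_pos hℓ _)

/-- Multiplication by `ℓ` modulo `ℓ ^ r - 1` rotates the digits. -/
lemma exists_rotate_digits (ℓ : ℕ) (hℓ : 0 < ℓ) {N r : ℕ} (hr : 1 ≤ r) (a : Fin r → ℕ)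
    (ha : ∀ j, N * a j < ℓ - 1) : ∃ a' : Fin r → ℕ, (∀ j, N * a' j < ℓ - 1) ∧
      digitSum ℓ a * ℓ ≡ digitSum ℓ a' [MOD ℓ ^ r - 1] := by
  obtain ⟨k, rfl⟩ : ∃ k, r = k + 1 := ⟨r - 1, by omega⟩
  -- The top digit wraps round to the bottom because `ℓ ^ r ≡ 1`.
  refine ⟨Fin.cons (a (Fin.last k)) fun j => a j.castSucc, ?_, ?_⟩
  · intro j
    refine Fin.cases ?_ (fun j => ?_) j
    · exact ha _
    · exact ha _
  · have h : digitSum ℓ a * ℓ = digitSum ℓ (Fin.cons (a (Fin.last k)) fun j => a j.castSucc) +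
        (ℓ ^ (k + 1) - 1) * a (Fin.last k) := by
      obtain ⟨w, hw⟩ : ∃ w, ℓ ^ (k + 1) = w + 1 :=
        ⟨ℓ ^ (k + 1) - 1, (Nat.succ_pred_eq_of_pos (pow_pos hℓ _)).symm⟩
      have e1 : digitSum ℓ a * ℓ = (∑ j : Fin k, a j.castSucc * ℓ ^ ((j : ℕ) + 1)) +
          a (Fin.last k) * ℓ ^ (k + 1) := by
        rw [digitSum, Fin.sum_univ_castSucc, add_mul, Finset.sum_mul]
        simp only [Fin.val_castSucc, Fin.val_last, pow_succ, mul_assoc]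
      rw [e1, digitSum, Fin.sum_univ_succ]
      simp only [Fin.cons_zero, Fin.cons_succ, Fin.val_zero, Fin.val_succ, pow_zero, mul_one]
      rw [hw, Nat.add_sub_cancel]
      ring
    rw [h]
    exact (Nat.modEq_iff_dvd' (Nat.le_add_right _ _)).2 (by simp) |>.symm

/-- Rotation permutes the digits and so preserves their bound. The factor `ℓ ^ c` will absorb both
the position inside a block and the Frobenius ambiguity of the residue field embedding. -/
lemma exists_small_exponent (ℓ : ℕ) (hℓ : 0 < ℓ) {N r : ℕ} (hr : 1 ≤ r) (a : Fin r → ℕ)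
    (ha : ∀ j, N * a j < ℓ - 1) (c : ℕ) :
    ∃ v, N * v < ℓ ^ r - 1 ∧ digitSum ℓ a * ℓ ^ c ≡ v [MOD ℓ ^ r - 1] := by
  induction c generalizing a with
  | zero => exact ⟨digitSum ℓ a, digitSum_lt ℓ hℓ N hr a ha, by simp [Nat.ModEq.refl]⟩
  | succ c ih =>
    obtain ⟨a', ha', h⟩ := exists_rotate_digits ℓ hℓ hr a ha
    obtain ⟨v, hv, h'⟩ := ih a' ha'
    refine ⟨v, hv, Nat.ModEq.trans ?_ h'⟩
    rw [pow_succ', ← mul_assoc]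
    exact h.mul_right _

/-- Raising to the power `ℓ` permutes the entries of the diagonal blocks. -/
lemma map_pow_frobenius_eq {Ω : Type*} [Field Ω] (ℓ : ℕ) {s : ℕ} {r : Fin s → ℕ}
    (y : Fin s → Ω) (b : Fin s → ℕ) (hy : ∀ i, y i ^ ℓ ^ r i = y i) (f : ℕ) :
    (Finset.univ.val.map fun x : (i : Fin s) × Fin (r i) =>
      (y x.1 ^ (b x.1 * ℓ ^ (x.2 : ℕ))) ^ ℓ ^ f) =
    Finset.univ.val.map fun x : (i : Fin s) × Fin (r i) => y x.1 ^ (b x.1 * ℓ ^ (x.2 : ℕ)) := by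
  let c : (i : Fin s) × Fin (r i) → Ω := fun x => y x.1 ^ (b x.1 * ℓ ^ (x.2 : ℕ))
  -- The `ℓ`-th power shifts each entry to the next position of its block; the last returns to the
  -- first by `hy`.
  let p : Equiv.Perm ((i : Fin s) × Fin (r i)) := Equiv.sigmaCongrRight fun i => finRotate (r i)
  have hp : ∀ x, c x ^ ℓ = c (p x) := by
    rintro ⟨i, j⟩
    have hyi := hy i
    change (y i ^ (b i * ℓ ^ (j : ℕ))) ^ ℓ = y i ^ (b i * ℓ ^ (finRotate (r i) j : ℕ))
    generalize r i = m at j hyi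
    cases m with
    | zero => exact j.elim0
    | succ k =>
      rw [← pow_mul, mul_assoc, ← pow_succ]
      rcases Fin.lt_or_eq_of_le (Fin.le_last j) with h | rfl
      · have h' := finRotate_of_lt (k := (j : ℕ)) (n := k) h
        rw [Fin.eta] at h'
        rw [h']
      · rw [finRotate_last, Fin.val_last, mul_comm, pow_mul, hyi]
        simp
  change (Finset.univ.val.map fun x => c x ^ ℓ ^ f) = Finset.univ.val.map c
  induction f with
  | zero => simp
  | succ f ih =>
    rw [← ih]
    have h : (fun x => c x ^ ℓ ^ (f + 1)) = (fun x => c x ^ ℓ ^ f) ∘ p := by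
      funext x
      rw [Function.comp_apply, ← hp, ← pow_mul (c x) ℓ, ← pow_succ']
    rw [h, ← Multiset.map_map]
    congr 1
    exact congrArg Finset.val (Finset.map_univ_equiv p)

/-- If a multiset of `n` small powers of an element of order `d` is stable under multiplication
by `e`, then `e = 1`. -/
lemma eq_one_of_map_mul_eq {Ω : Type*} [Field Ω] {κ : Type*} [Fintype κ] [Nonempty κ] {ζ e : Ω}
    (v : κ → ℕ) (hv : ∀ x, Fintype.card κ * v x < orderOf ζ)
    (h : (Finset.univ.val.map fun x => ζ ^ v x) = Finset.univ.val.map fun x => e * ζ ^ v x) :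
    e = 1 := by
  obtain ⟨x⟩ := ‹Nonempty κ›
  have hζ0 : ζ ≠ 0 := by
    -- `orderOf 0 = 0`, which contradicts the strict bound `hv`.
    rintro rfl
    have := hv x
    simp at this
  have hprod := congrArg Multiset.prod h
  rw [← Finset.prod_eq_multiset_prod, ← Finset.prod_eq_multiset_prod, Finset.prod_mul_distrib,
    Finset.prod_const, Finset.card_univ] at hprod
  have hen : e ^ Fintype.card κ = 1 :=
    (mul_eq_right₀ (Finset.prod_ne_zero_iff.2 fun x _ => pow_ne_zero _ hζ0)).1 hprod.symm
  have hmem : e * ζ ^ v x ∈ Finset.univ.val.map fun x => ζ ^ v x := by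
    rw [h]
    exact Multiset.mem_map_of_mem _ (Finset.mem_univ x)
  obtain ⟨y, -, hy⟩ := Multiset.mem_map.1 hmem
  -- Raising `ζ ^ v y = e * ζ ^ v x` to the power `card κ` removes `e`, and both exponents stay
  -- below the order of `ζ`.
  have hpow : ζ ^ (Fintype.card κ * v y) = ζ ^ (Fintype.card κ * v x) := by
    rw [mul_comm, pow_mul, hy, mul_pow, hen, one_mul, ← pow_mul, mul_comm]
  have hvv : v y = v x := Nat.eq_of_mul_eq_mul_left (Fintype.card_pos_iff.2 ⟨x⟩)
    (pow_injOn_Iio_orderOf (hv y) (hv x) hpow)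
  rw [hvv] at hy
  exact (mul_eq_right₀ (pow_ne_zero _ hζ0)).1 hy.symm

end Digits

/-! ### Orders and relations of fundamental characters -/

section FundamentalCharacters

variable {F : Type*} [Field F] {ℓ : ℕ} {𝔏 : Ideal (𝓞 F)} {𝔓 : Ideal (IntBar F)}
  {Ω : Type*} [Field Ω]

lemma natCast_mem_of_liesOver [𝔓.LiesOver 𝔏] (h𝔏 : (ℓ : 𝓞 F) ∈ 𝔏) : (ℓ : IntBar F) ∈ 𝔓 := by
  rw [Ideal.over_def 𝔓 𝔏, Ideal.mem_comap, map_natCast] at h𝔏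
  exact h𝔏

lemma IsFundamentalCharacter.pow_eq_one {r : ℕ} {ψ : inertiaGrp 𝔓 →* Ωˣ}
    (hψ : IsFundamentalCharacter ℓ 𝔏 𝔓 r ψ) (σ : inertiaGrp 𝔓) : ψ σ ^ (ℓ ^ r - 1) = 1 := by
  obtain ⟨hd, π, hπ, x, hx, τ, -, -, rfl⟩ := hψ
  rw [MonoidHom.comp_apply, ← map_pow, rootCharacter_pow, map_one]

variable [Fact ℓ.Prime]

lemma natCast_pow_sub_one_notMem [𝔓.IsPrime] (h : (ℓ : IntBar F) ∈ 𝔓) {r : ℕ} (hr : 1 ≤ r) :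
    ((ℓ ^ r - 1 : ℕ) : IntBar F) ∉ 𝔓 := by
  intro h'
  apply Ideal.IsPrime.ne_top ‹𝔓.IsPrime›
  rw [Ideal.eq_top_iff_one]
  have h1 : (1 : IntBar F) = (ℓ : IntBar F) ^ r - ((ℓ ^ r - 1 : ℕ) : IntBar F) := by
    rw [Nat.cast_sub (Nat.one_le_pow _ _ (Fact.out : ℓ.Prime).pos)]
    push_cast
    ring
  rw [h1]
  exact 𝔓.sub_mem (Ideal.pow_mem_of_mem _ h _ hr) h'

lemma charP_quotient [𝔓.IsPrime] (h : (ℓ : IntBar F) ∈ 𝔓) : CharP (IntBar F ⧸ 𝔓) ℓ := by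
  rw [CharP.charP_iff_prime_eq_zero Fact.out, ← map_natCast (Ideal.Quotient.mk 𝔓),
    Ideal.Quotient.eq_zero_iff_mem]
  exact h

lemma IsFundamentalCharacter.pow_eq_self {r : ℕ} {ψ : inertiaGrp 𝔓 →* Ωˣ}
    (hψ : IsFundamentalCharacter ℓ 𝔏 𝔓 r ψ) (σ : inertiaGrp 𝔓) : ψ σ ^ ℓ ^ r = ψ σ := by
  rw [← Nat.sub_add_cancel (Nat.one_le_pow r ℓ (Fact.out : ℓ.Prime).pos), pow_succ,
    hψ.pow_eq_one, one_mul]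

variable [NumberField F] [𝔏.IsPrime] [𝔓.IsPrime] [𝔓.LiesOver 𝔏]

lemma IsFundamentalCharacter.exists_orderOf_eq (h𝔏 : (ℓ : 𝓞 F) ∈ 𝔏) {r : ℕ} (hr : 1 ≤ r)
    {ψ : inertiaGrp 𝔓 →* Ωˣ} (hψ : IsFundamentalCharacter ℓ 𝔏 𝔓 r ψ) :
    ∃ σ, orderOf (ψ σ) = ℓ ^ r - 1 := by
  obtain ⟨hd, π, hπ, x, hx, τ, hπ1, hπ2, rfl⟩ := hψ
  have h0 : 𝔏 ≠ ⊥ := by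
    rintro rfl
    exact (Fact.out : ℓ.Prime).ne_zero (by exact_mod_cast (Ideal.mem_bot.1 h𝔏))
  have : 𝔏.IsMaximal := Ideal.IsPrime.isMaximal ‹_› h0
  have : 𝔓.IsMaximal := Ideal.IsMaximal.of_liesOver_isMaximal 𝔓 𝔏
  have hτ : Function.Injective τ := by
    let _ : Field (IntBar F ⧸ 𝔓) := Ideal.Quotient.field 𝔓
    exact τ.injective
  obtain ⟨σ, hσ⟩ := exists_orderOf_rootCharacter_eq 𝔏 h0 𝔓 hd
    (natCast_pow_sub_one_notMem (natCast_mem_of_liesOver h𝔏) hr) hπ hπ1 hπ2 hx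
  refine ⟨σ, ?_⟩
  exact (orderOf_injective _ (Units.map_injective hτ) _).trans hσ

/-- A fundamental character of niveau `r ∣ R` is a power of a given one of niveau `R`. -/
lemma IsFundamentalCharacter.exists_eq_pow (h𝔏 : (ℓ : 𝓞 F) ∈ 𝔏) {r R : ℕ} (hr : 1 ≤ r)
    (hR : R ≠ 0) (hrR : r ∣ R) {ψ Ψ : inertiaGrp 𝔓 →* Ωˣ}
    (hψ : IsFundamentalCharacter ℓ 𝔏 𝔓 r ψ) (hΨ : IsFundamentalCharacter ℓ 𝔏 𝔓 R Ψ) :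
    ∃ m f, ℓ ^ R - 1 = (ℓ ^ r - 1) * m ∧ ∀ σ, ψ σ = Ψ σ ^ (m * ℓ ^ f) := by
  obtain ⟨hd, π, hπ, x, hx, τ, hπ1, hπ2, rfl⟩ := hψ
  obtain ⟨hD, π', hπ', x', hx', τ', hπ1', hπ2', rfl⟩ := hΨ
  have hℓ𝔓 : (ℓ : IntBar F) ∈ 𝔓 := natCast_mem_of_liesOver h𝔏
  obtain ⟨m, hm⟩ : ℓ ^ r - 1 ∣ ℓ ^ R - 1 := by
    obtain ⟨k, rfl⟩ := hrR
    simpa [pow_mul] using Nat.sub_dvd_pow_sub_pow (ℓ ^ r) 1 k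
  have : CharP (IntBar F ⧸ 𝔓) ℓ := charP_quotient hℓ𝔓
  -- The two characters may use different residue field embeddings; on the values involved these
  -- differ by the `f`-th power of Frobenius.
  obtain ⟨f, hf⟩ := exists_eq_pow_frobenius ℓ τ τ' hR
  refine ⟨m, f, hm, fun σ => ?_⟩
  have h1 := rootCharacter_eq_pow hm hd hD (natCast_pow_sub_one_notMem hℓ𝔓 hr) hπ hπ'
    hπ1 hπ2 hπ1' hπ2' hx hx' σ
  have h2 := rootCharacter_pow 𝔓 hD hπ' hx' σ
  rw [MonoidHom.comp_apply, MonoidHom.comp_apply, h1]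
  generalize rootCharacter 𝔓 hD hπ' hx' σ = y at h2 ⊢
  have h3 : (y : IntBar F ⧸ 𝔓) ^ ℓ ^ R = y := by
    rw [← Units.val_pow_eq_pow_val,
      ← Nat.sub_add_cancel (Nat.one_le_pow R ℓ (Fact.out : ℓ.Prime).pos), pow_succ, h2, one_mul]
  apply Units.ext
  rw [map_pow, Units.val_pow_eq_pow_val, Units.val_pow_eq_pow_val, mul_comm, pow_mul]
  congr 1
  exact hf _ h3

end FundamentalCharacters

/-! ### Inner twists restricted to inertia -/

section Main

variable {F : Type*} [Field F] {ℓ : ℕ} {L : Type*} [Field L] {n : ℕ}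
  {ρ : GalGrp F →* GL (Fin n) L} {𝔏 : Ideal (𝓞 F)} {𝔓 : Ideal (IntBar F)}
  {ψ : ℕ → inertiaGrp 𝔓 →* (AlgebraicClosure L)ˣ} {t : ℤ} {s : ℕ} {r : Fin s → ℕ}
  {a : (i : Fin s) → Fin (r i) → ℕ}

open scoped Pointwise in
/-- Triviality of a character on one inertia group above `𝔏` gives triviality on all of them. -/
lemma isUnramifiedAt_of_forall_inertia [NumberField F] [𝔓.IsPrime] [𝔓.LiesOver 𝔏] {H : Type*} [CommGroup H] {f : GalGrp F →* H}
    (hf : ∀ σ : inertiaGrp 𝔓, f σ = 1) : IsUnramifiedAt f 𝔏 := by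
  intro 𝔓' h𝔓' hover σ hσ
  obtain ⟨g, hg⟩ := exists_smul_eq_of_under_eq F 𝔓 𝔓'
    ((Ideal.over_def 𝔓 𝔏).symm.trans (Ideal.over_def 𝔓' 𝔏))
  -- Inertia groups at primes above `𝔏` are conjugate, and a homomorphism to a commutative group
  -- ignores conjugation.
  have hmem : g⁻¹ * σ * g ∈ inertiaGrp 𝔓 := by
    intro x
    have h1 := hσ (g • x)
    rw [hg] at h1
    have h2 := (Ideal.mem_pointwise_smul_iff_inv_smul_mem (a := g)).1 h1
    rw [smul_sub, inv_smul_smul] at h2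
    rw [mul_smul, mul_smul]
    exact h2
  have h := hf ⟨_, hmem⟩
  change f (g⁻¹ * σ * g) = 1 at h
  rwa [map_mul, map_mul, map_inv, mul_comm _ (f σ), inv_mul_cancel_right] at h

variable [Fact ℓ.Prime] [CharP L ℓ]

/-- The multiset of diagonal characters is stable under multiplication by the character of an
inner twist. -/
lemma HasInertiaShape.map_diag_eq {K : Type*} [Field K] [Algebra K L]
    (hψ : ∀ m, 1 ≤ m → IsFundamentalCharacter ℓ 𝔏 𝔓 m (ψ m))
    (hshape : HasInertiaShape ℓ 𝔓 ρ ψ t s r a) {γ : L ≃ₐ[K] L} {ε : GalGrp F →* Lˣ}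
    (hε : IsInnerTwist ρ γ ε) (σ : inertiaGrp 𝔓) :
    (Finset.univ.val.map fun x : (i : Fin s) × Fin (r i) =>
      (ψ (r x.1) σ : AlgebraicClosure L) ^ (digitSum ℓ (a x.1) * ℓ ^ (x.2 : ℕ))) =
    Finset.univ.val.map fun x : (i : Fin s) × Fin (r i) =>
      algebraMap L (AlgebraicClosure L) (ε σ : Lˣ) *
        (ψ (r x.1) σ : AlgebraicClosure L) ^ (digitSum ℓ (a x.1) * ℓ ^ (x.2 : ℕ)) := by
  let Ω := AlgebraicClosure L
  have : CharP Ω ℓ := charP_of_injective_algebraMap (algebraMap L Ω).injective ℓ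
  obtain ⟨hn, P, hP⟩ := hshape.shape
  obtain ⟨M, hMA, hM, hdiag⟩ := hP σ
  obtain ⟨U, -, hU⟩ := hε
  have hMd : ∀ i j k, M ⟨i, j⟩ ⟨i, k⟩ =
      diagBlock ℓ (r i) (ψ (r i)) (digitSum ℓ (a i)) σ j k := fun i j k =>
    congrFun (congrFun (hdiag i) j) k
  have hMx : ∀ x, M x x = (ψ (r x.1) σ : Ω) ^ (digitSum ℓ (a x.1) * ℓ ^ (x.2 : ℕ)) := by
    rintro ⟨i, j⟩
    rw [hMd, diagBlock, Matrix.diagonal_apply_eq, Units.val_pow_eq_pow_val]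
  let γ' : Ω →+* Ω := (IsAlgClosure.equivOfEquiv Ω Ω (γ : L ≃+* L) : Ω ≃+* Ω)
  have hγ' : ∀ y : L, γ' (algebraMap L Ω y) = algebraMap L Ω (γ y) := fun y =>
    IsAlgClosure.equivOfEquiv_algebraMap Ω Ω (γ : L ≃+* L) y
  have hR : ∏ i, r i ≠ 0 := Finset.prod_ne_zero_iff.2 fun i _ =>
    Nat.one_le_iff_ne_zero.1 (hshape.one_le_r i)
  -- Every `r i` divides `∏ i, r i`, so all values in play satisfy `z ^ ℓ ^ (∏ i, r i) = z`, and a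
  -- single exponent `f` describes `γ'` on all of them.
  obtain ⟨f, hf⟩ := exists_eq_pow_frobenius ℓ γ' (RingHom.id Ω) hR
  have hfix : ∀ (m : ℕ), 1 ≤ m → m ∣ ∏ i, r i → ∀ k : ℕ,
      ((ψ m σ : Ω) ^ k) ^ ℓ ^ (∏ i, r i) = (ψ m σ : Ω) ^ k := by
    rintro m hm ⟨q, hq⟩ k
    have h1 : ∀ q : ℕ, (ψ m σ) ^ ℓ ^ (m * q) = ψ m σ := by
      intro q
      induction q with
      | zero => simp
      | succ q ih => rw [mul_add, mul_one, pow_add, pow_mul, ih, (hψ m hm).pow_eq_self]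
    rw [← pow_mul, mul_comm, pow_mul, hq, ← Units.val_pow_eq_pow_val (ψ m σ), h1]
  -- `ψ 1` takes values in the prime field, so the twist by `ψ 1 ^ t` commutes with applying `γ'`.
  have hz : γ' ((ψ 1 σ ^ t : Ωˣ) : Ω) = ((ψ 1 σ ^ t : Ωˣ) : Ω) := by
    have h1 : Units.map (γ' : Ω →* Ω) (ψ 1 σ) = ψ 1 σ := by
      apply Units.ext
      have h2 := hf _ (hfix 1 le_rfl (one_dvd _) 1)
      rw [pow_one] at h2
      have h3 : ∀ f : ℕ, ψ 1 σ ^ ℓ ^ f = ψ 1 σ := by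
        intro f
        have h4 := (hψ 1 le_rfl).pow_eq_self σ
        rw [pow_one] at h4
        induction f with
        | zero => simp
        | succ f ih => rw [pow_succ, pow_mul, ih, h4]
      change γ' (ψ 1 σ : Ω) = _
      rw [h2, RingHom.id_apply, ← Units.val_pow_eq_pow_val, h3]
    have h2 : Units.map (γ' : Ω →* Ω) (ψ 1 σ ^ t) = ψ 1 σ ^ t := by rw [map_zpow, h1]
    exact congrArg Units.val h2
  let A : Matrix (Fin n) (Fin n) Ω := ((ψ 1 σ ^ t : Ωˣ) : Ω) •
    ((ρ (σ : GalGrp F) : Matrix (Fin n) (Fin n) L).map (algebraMap L Ω))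
  let U' : GL (Fin n) Ω := Matrix.GeneralLinearGroup.map (algebraMap L Ω) U
  have hconj : A.map γ' = (U' : Matrix (Fin n) (Fin n) Ω) *
      (algebraMap L Ω (ε σ : Lˣ) • A) * ((U'⁻¹ : GL (Fin n) Ω) : Matrix (Fin n) (Fin n) Ω) := by
    have h1 : (ρ (σ : GalGrp F) : Matrix (Fin n) (Fin n) L).map γ =
        (U : Matrix (Fin n) (Fin n) L) *
          (((ε σ : Lˣ) : L) • (ρ (σ : GalGrp F) : Matrix (Fin n) (Fin n) L)) *
          ((U⁻¹ : GL (Fin n) L) : Matrix (Fin n) (Fin n) L) := by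
      have h2 := congrArg (Units.val (α := Matrix (Fin n) (Fin n) L)) (hU σ)
      have h3 : ((twist ρ ε σ : GL (Fin n) L) : Matrix (Fin n) (Fin n) L) =
          ((ε σ : Lˣ) : L) • (ρ (σ : GalGrp F) : Matrix (Fin n) (Fin n) L) := by
        change Matrix.scalar (Fin n) ((ε σ : Lˣ) : L) * _ = _
        rw [Matrix.scalar_apply, ← Matrix.smul_eq_diagonal_mul]
      rw [Units.val_mul, Units.val_mul, h3] at h2
      exact h2
    have h4 : A.map γ' = ((ψ 1 σ ^ t : Ωˣ) : Ω) •
        (((ρ (σ : GalGrp F) : Matrix (Fin n) (Fin n) L).map γ).map (algebraMap L Ω)) := by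
      ext i j
      simp only [A, Matrix.map_apply, Matrix.smul_apply, smul_eq_mul, map_mul, hz, hγ']
    have hsm : ∀ (c : L) (B : Matrix (Fin n) (Fin n) L),
        (c • B).map (algebraMap L Ω) = algebraMap L Ω c • B.map (algebraMap L Ω) := by
      intro c B
      ext i j
      simp
    rw [h4, h1, Matrix.map_mul, Matrix.map_mul, hsm, smul_comm (algebraMap L Ω _),
      Matrix.mul_smul _ ((ψ 1 σ ^ t : Ωˣ) : Ω), Matrix.smul_mul ((ψ 1 σ ^ t : Ωˣ) : Ω)]
    rfl
  have hA : M = ((P : Matrix (Fin n) (Fin n) Ω) * A *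
      ((P⁻¹ : GL (Fin n) Ω) : Matrix (Fin n) (Fin n) Ω)).submatrix
        (finSigmaFinEquiv.trans (finCongr hn)) (finSigmaFinEquiv.trans (finCongr hn)) := by
    rw [hMA, Units.val_mul, Units.val_mul, Units.val_mul]
    congr 3
    change Matrix.scalar (Fin n) ((ψ 1 σ ^ t : Ωˣ) : Ω) * _ = _
    rw [Matrix.scalar_apply, ← Matrix.smul_eq_diagonal_mul]
    rfl
  have key := map_diag_eq_of_conj (finSigmaFinEquiv.trans (finCongr hn)) P U' A γ'
    (algebraMap L Ω (ε σ : Lˣ)) hconj M hA hM (fun i j k hjk => by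
      rw [hMd, diagBlock, Matrix.diagonal_apply_ne _ hjk])
  simp only [hMx] at key
  -- By Frobenius stability of the blocks, the left-hand multiset may be replaced by its image under
  -- `γ'`.
  rw [← key, ← map_pow_frobenius_eq ℓ (fun i => (ψ (r i) σ : Ω)) (fun i => digitSum ℓ (a i))
    (fun i => by
      rw [← Units.val_pow_eq_pow_val, (hψ (r i) (hshape.one_le_r i)).pow_eq_self]) f]
  congr 1
  funext x
  exact (hf _ (hfix (r x.1) (hshape.one_le_r x.1)
    (Finset.dvd_prod_of_mem _ (Finset.mem_univ _)) _)).symm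

/-- The character of an inner twist is trivial on the inertia group at which the shape is given. -/
lemma HasInertiaShape.innerTwist_eq_one [NumberField F] [𝔏.IsPrime] [𝔓.IsPrime]
    [𝔓.LiesOver 𝔏] {K : Type*} [Field K] [Algebra K L]
    (h𝔏 : (ℓ : 𝓞 F) ∈ 𝔏) (hψ : ∀ m, 1 ≤ m → IsFundamentalCharacter ℓ 𝔏 𝔓 m (ψ m))
    (hshape : HasInertiaShape ℓ 𝔓 ρ ψ t s r a)
    (ha : ∀ i j, (a i j : ℚ) < ((ℓ : ℚ) - 1) / (2 * (n : ℚ))) {γ : L ≃ₐ[K] L}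
    {ε : GalGrp F →* Lˣ} (hε : IsInnerTwist ρ γ ε) (σ : inertiaGrp 𝔓) : ε σ = 1 := by
  let Ω := AlgebraicClosure L
  -- The digit bound enters below only through `n * a i j < ℓ - 1`.
  have hℓ : 0 < ℓ := (Fact.out : ℓ.Prime).pos
  have hn : 1 ≤ n := hshape.one_le_s.trans hshape.s_le
  have ha' : ∀ i j, n * a i j < ℓ - 1 := by
    intro i j
    have h1 := ha i j
    have hnQ : (0 : ℚ) < 2 * (n : ℚ) := by positivity
    rw [lt_div_iff₀ hnQ] at h1
    have h2 : a i j * (2 * n) + 1 < ℓ + 0 := by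
      have : ((a i j * (2 * n) + 1 : ℕ) : ℚ) < (ℓ : ℕ) := by
        push_cast
        linarith
      exact_mod_cast this
    have h3 : n * a i j ≤ a i j * (2 * n) := by nlinarith [Nat.zero_le (n * a i j)]
    omega
  let R := ∏ i, r i
  have hR : R ≠ 0 := Finset.prod_ne_zero_iff.2 fun i _ =>
    Nat.one_le_iff_ne_zero.1 (hshape.one_le_r i)
  have hR1 : 1 ≤ R := Nat.one_le_iff_ne_zero.2 hR
  have hΨ := hψ R hR1
  obtain ⟨σ₀, hσ₀⟩ := hΨ.exists_orderOf_eq h𝔏 hR1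
  have hcard : Fintype.card ((i : Fin s) × Fin (r i)) = n := by
    obtain ⟨h, -⟩ := hshape.shape
    simpa using h
  have : Nonempty ((i : Fin s) × Fin (r i)) := by
    rw [← Fintype.card_pos_iff, hcard]
    exact hn
  have hexp : ∀ x : (i : Fin s) × Fin (r i), ∃ v, n * v < ℓ ^ R - 1 ∧
      ∀ σ, ψ (r x.1) σ ^ (digitSum ℓ (a x.1) * ℓ ^ (x.2 : ℕ)) = ψ R σ ^ v := by
    rintro ⟨i, j⟩
    obtain ⟨m, f, hm, hmf⟩ := (hψ (r i) (hshape.one_le_r i)).exists_eq_pow h𝔏 (hshape.one_le_r i)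
      hR (Finset.dvd_prod_of_mem _ (Finset.mem_univ i)) hΨ
    -- `j` is the position in the block and `f` the Frobenius discrepancy. Multiplying by `m = (ℓ ^
    -- R - 1) / (ℓ ^ r i - 1)` carries both the congruence and the bound from niveau `r i` to niveau
    -- `R`.
    obtain ⟨v, hv, hvm⟩ := exists_small_exponent ℓ hℓ (hshape.one_le_r i) (a i) (ha' i) (j + f)
    have hm0 : 0 < m := by
      rcases Nat.eq_zero_or_pos m with rfl | h
      · obtain ⟨hd, -⟩ := hΨ
        exact absurd hm hd
      · exact h
    refine ⟨v * m, ?_, fun σ => ?_⟩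
    · rw [hm, ← mul_assoc]
      exact Nat.mul_lt_mul_of_pos_right hv hm0
    · have h1 : digitSum ℓ (a i) * ℓ ^ ((j : ℕ) + f) * m ≡ v * m [MOD ℓ ^ R - 1] := by
        rw [hm]
        exact Nat.ModEq.mul_right' m hvm
      change ψ (r i) σ ^ (digitSum ℓ (a i) * ℓ ^ (j : ℕ)) = _
      rw [hmf, ← pow_mul]
      refine (pow_eq_pow_iff_modEq.2 ((h1.of_dvd
        (orderOf_dvd_of_pow_eq_one (hΨ.pow_eq_one σ))).symm.trans ?_)).symm
      rw [pow_add]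
      exact congrArg (· % _) (by ring)
  choose v hv hvψ using hexp
  have hmult : ∀ σ : inertiaGrp 𝔓,
      (Finset.univ.val.map fun x => (ψ R σ : Ω) ^ v x) =
        Finset.univ.val.map fun x => algebraMap L Ω (ε σ : Lˣ) * (ψ R σ : Ω) ^ v x := by
    intro σ
    have h := hshape.map_diag_eq hψ hε σ
    simpa only [← Units.val_pow_eq_pow_val, hvψ] using h
  have hinj : ∀ σ : inertiaGrp 𝔓, algebraMap L Ω (ε σ : Lˣ) = 1 → ε σ = 1 := by
    intro σ h
    apply Units.ext
    apply (algebraMap L Ω).injective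
    rw [h, Units.val_one, map_one]
  have h₀ : ε σ₀ = 1 := by
    refine hinj _ (eq_one_of_map_mul_eq v (fun x => ?_) (hmult σ₀))
    rw [hcard, orderOf_units, hσ₀]
    exact hv x
  -- On the kernel of `ψ R` the multiset consists of `n ≥ 1` copies of `1`, so its stability forces
  -- the multiplier to be `1`.
  have hker : ∀ κ : inertiaGrp 𝔓, ψ R κ = 1 → ε κ = 1 := by
    intro κ hκ
    have h := hmult κ
    rw [hκ] at h
    simp only [Units.val_one, one_pow, mul_one, Multiset.map_const'] at h
    refine hinj _ ?_
    have hc : Multiset.card (Finset.univ : Finset ((i : Fin s) × Fin (r i))).val ≠ 0 := by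
      rw [Finset.card_val, Finset.card_univ, hcard]
      omega
    exact ((Multiset.replicate_right_inj hc).1 h).symm
  have : NeZero (ℓ ^ R - 1) := ⟨hΨ.choose⟩
  have hprim : IsPrimitiveRoot (ψ R σ₀) (ℓ ^ R - 1) := hσ₀ ▸ IsPrimitiveRoot.orderOf (ψ R σ₀)
  -- `ψ R σ₀` is a primitive root of unity, so `σ` differs from some power of `σ₀` by an element of
  -- the kernel of `ψ R`.
  obtain ⟨k, -, hk⟩ := (IsPrimitiveRoot.coe_units_iff.2 hprim).eq_pow_of_pow_eq_one
    (ξ := ((ψ R σ : Ωˣ) : Ω)) (by rw [← Units.val_pow_eq_pow_val, hΨ.pow_eq_one, Units.val_one])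
  have hk' : ψ R σ₀ ^ k = ψ R σ := Units.ext (by rw [Units.val_pow_eq_pow_val, hk])
  have h1 := hker (σ * (σ₀ ^ k)⁻¹) (by rw [map_mul, map_inv, map_pow, hk', mul_inv_cancel])
  have h2 : ((σ * (σ₀ ^ k)⁻¹ : inertiaGrp 𝔓) : GalGrp F) =
      (σ : GalGrp F) * ((σ₀ : GalGrp F) ^ k)⁻¹ := by simp
  rw [h2, map_mul, map_inv, map_pow, h₀, one_pow, inv_one, mul_one] at h1
  exact h1

end Main

end InnerTwist

end

theorem mainTheorem8 {F : Type*} [Field F] [NumberField F]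
    (ℓ : ℕ) [Fact ℓ.Prime]
    {K : Type*} [Field K] [Algebra (ZMod ℓ) K] (hK : Finite K ∨ IsAlgClosure (ZMod ℓ) K)
    {L : Type*} [Field L] [Algebra K L] [IsGalois K L]
    [TopologicalSpace L] [DiscreteTopology L]
    {n : ℕ} (ρ : InnerTwist.GalGrp F →ₜ* GL (Fin n) L)
    (𝔏 : Ideal (NumberField.RingOfIntegers F)) [𝔏.IsPrime]
    (h𝔏 : (ℓ : NumberField.RingOfIntegers F) ∈ 𝔏)
    (𝔓 : Ideal (InnerTwist.IntBar F)) [𝔓.IsPrime] [𝔓.LiesOver 𝔏]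
    (ψ : ℕ → InnerTwist.inertiaGrp 𝔓 →* (AlgebraicClosure L)ˣ)
    (t : ℤ) (s : ℕ) (r : Fin s → ℕ) (a : (i : Fin s) → Fin (r i) → ℕ)
    (hψ : ∀ m, 1 ≤ m → InnerTwist.IsFundamentalCharacter ℓ 𝔏 𝔓 m (ψ m))
    (hshape : InnerTwist.HasInertiaShape ℓ 𝔓 (ρ : InnerTwist.GalGrp F →* GL (Fin n) L) ψ t s r a)
    (ha : ∀ i j, (a i j : ℚ) < ((ℓ : ℚ) - 1) / (2 * (n : ℚ))) :
    (∀ (γ : L ≃ₐ[K] L) (ε : InnerTwist.GalGrp F →ₜ* Lˣ),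
      InnerTwist.IsInnerTwist (ρ : InnerTwist.GalGrp F →* GL (Fin n) L) γ
        (ε : InnerTwist.GalGrp F →* Lˣ) →
      InnerTwist.IsUnramifiedAt (ε : InnerTwist.GalGrp F →* Lˣ) 𝔏) ∧
    (Even n → (∀ g, ρ g ∈ InnerTwist.GSp n L) →
      ∀ (γ : L ≃ₐ[K] L) (ε : InnerTwist.GalGrp F →ₜ* Lˣ),
        InnerTwist.IsSymplecticInnerTwist (ρ : InnerTwist.GalGrp F →* GL (Fin n) L) γ
          (ε : InnerTwist.GalGrp F →* Lˣ) →
        InnerTwist.IsUnramifiedAt (ε : InnerTwist.GalGrp F →* Lˣ) 𝔏) := by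
  have : CharP (ZMod ℓ) ℓ := ZMod.charP ℓ
  have : CharP K ℓ := charP_of_injective_algebraMap (algebraMap (ZMod ℓ) K).injective ℓ
  have : CharP L ℓ := charP_of_injective_algebraMap (algebraMap K L).injective ℓ
  have main : ∀ (γ : L ≃ₐ[K] L) (ε : InnerTwist.GalGrp F →ₜ* Lˣ),
      InnerTwist.IsInnerTwist (ρ : InnerTwist.GalGrp F →* GL (Fin n) L) γ
        (ε : InnerTwist.GalGrp F →* Lˣ) →
      InnerTwist.IsUnramifiedAt (ε : InnerTwist.GalGrp F →* Lˣ) 𝔏 := fun γ ε hε =>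
    InnerTwist.isUnramifiedAt_of_forall_inertia (𝔓 := 𝔓) fun σ =>
      hshape.innerTwist_eq_one h𝔏 hψ ha hε σ
  -- Conjugacy under `GSp` is in particular conjugacy under `GL`.
  refine ⟨main, fun _ _ γ ε hε => main γ ε ?_⟩
  obtain ⟨M, -, hM⟩ := hε
  exact ⟨M, Subgroup.mem_top M, hM⟩
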